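/- For a closed set $C\subset\mathbb{R}^n$ let $R_M(C)=\inf\{r>0: C\subset B_n(r)\}$, where $B_n(r)$ is the closed ball of radius $r$ centred at the origin (and $R_M(C)=\infty$ if $C$ is unbounded). A stationary and isotropic Poisson hyperplane process in $\mathbb{R}^n$ with intensity $\gamma>0$ is a Poisson process on the space of affine hyperplanes with intensity measure $$\Theta(A)=2\gamma\int_{S^{n-1}}\int_0^\infty 1\{H(u,\tau)\in A\}\,d\tau\,\sigma(du),\qquad H(u,\tau)=\{x:\langle x,u\rangle=\tau\},$$ $\sigma$ being the uniform probability measure on $S^{n-1}$. Its zero cell is the (closed) cell, containing the origin, of the tessellation that the hyperplanes induce. **Proposition.** Let $R>0$. There are constants $\rho_u>0$ and $\rho_\ell>0$, depending only on $R$, such that the following holds. Let $\alpha,\rho\in\mathbb{R}$, and for every $n\ge 1$ let $X_n$ be a stationary and isotropic Poisson hyperplane process in $\mathbb{R}^n$ with intensity $\gamma_n>0$ and zero cell $Z_{0,n}$, and let $\mathcal{L}_n$ be a random linear subspace of $\mathbb{R}^n$ (with an arbitrary distribution, for instance the uniform one) of dimension $m_n<n$, independent of $X_n$. Suppose that $m_n\to\infty$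 and $\gamma_n\sim\rho\, n^{\alpha-1}m_n$ as $n\to\infty$. If $\rho>\rho_u$, then $$\lim_{n\to\infty}\mathbb{P}\left(R_M(Z_{0,n}\cap\mathcal{L}_n)\ge n^{\frac32-\alpha}R\right)=0,$$ and if $\rho<\rho_\ell$, then $$\lim_{n\to\infty}\mathbb{P}\left(R_M(Z_{0,n}\cap\mathcal{L}_n)\le n^{\frac32-\alpha}R\right)=0.$$ -/

import Mathlib

open MeasureTheory ProbabilityTheory Filter Topology Asymptotics
open scoped ENNReal

/-- The affine hyperplane `H(u, τ) = {x | ⟨x, u⟩ = τ}` of `ℝⁿ`, as a set. -/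
def hyperplaneSet {n : ℕ} (u : EuclideanSpace ℝ (Fin n)) (τ : ℝ) :
    Set (EuclideanSpace ℝ (Fin n)) :=
  {x | inner ℝ x u = τ}

/-- The space of affine hyperplanes of `ℝⁿ`. -/
structure Hyperplane (n : ℕ) : Type where
  carrier : Set (EuclideanSpace ℝ (Fin n))
  exists_eq : ∃ u ∈ Metric.sphere (0 : EuclideanSpace ℝ (Fin n)) 1, ∃ τ : ℝ,
    carrier = hyperplaneSet u τ

/-- The Borel σ-algebra (of the Fell topology) on hyperplanes: it is generated by the sets
`{H | H ∩ C ≠ ∅}` with `C` compact. -/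
instance Hyperplane.instMeasurableSpace (n : ℕ) : MeasurableSpace (Hyperplane n) :=
  MeasurableSpace.generateFrom
    {S | ∃ C : Set (EuclideanSpace ℝ (Fin n)), IsCompact C ∧
      S = {H : Hyperplane n | (H.carrier ∩ C).Nonempty}}

/-- The Borel σ-algebra (of the Fell topology) on linear subspaces of `ℝⁿ`: it is generated by
the sets `{L | L ∩ C ≠ ∅}` with `C` compact. -/
instance subspaceMeasurableSpace (n : ℕ) :
    MeasurableSpace (Submodule ℝ (EuclideanSpace ℝ (Fin n))) :=
  MeasurableSpace.generateFrom
    {S | ∃ C : Set (EuclideanSpace ℝ (Fin n)), IsCompact C ∧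
      S = {L : Submodule ℝ (EuclideanSpace ℝ (Fin n)) |
        ((L : Set (EuclideanSpace ℝ (Fin n))) ∩ C).Nonempty}}

/-- The parametrization `(u, τ) ↦ H(u, τ)` of hyperplanes by unit normals and signed distances. -/
def hyperplaneOf (n : ℕ) (p : Metric.sphere (0 : EuclideanSpace ℝ (Fin n)) 1 × ℝ) :
    Hyperplane n :=
  ⟨hyperplaneSet p.1.1 p.2, p.1.1, p.1.2, p.2, rfl⟩

theorem measurable_hyperplaneOf (n : ℕ) : Measurable (hyperplaneOf n) := by
  refine measurable_generateFrom ?_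
  rintro _ ⟨C, hC, rfl⟩
  refine IsClosed.measurableSet ?_
  have hcs : CompactSpace C := isCompact_iff_compactSpace.mp hC
  have hcl : IsClosed {q : C × (Metric.sphere (0 : EuclideanSpace ℝ (Fin n)) 1 × ℝ) |
      inner ℝ (q.1 : EuclideanSpace ℝ (Fin n)) (q.2.1 : EuclideanSpace ℝ (Fin n)) = q.2.2} :=
    isClosed_eq (by fun_prop) (by fun_prop)
  convert isClosedMap_snd_of_compactSpace _ hcl using 1
  ext p
  constructor
  · rintro ⟨x, hx, hxC⟩
    exact ⟨(⟨x, hxC⟩, p), hx, rfl⟩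
  · rintro ⟨⟨x, q⟩, hx, rfl⟩
    exact ⟨x.1, hx, x.2⟩

/-- The normalized spherical Lebesgue measure (uniform probability) on `S^{n-1}`, `n ≥ 1`. -/
noncomputable def uniformSphere (n : ℕ) :
    Measure (Metric.sphere (0 : EuclideanSpace ℝ (Fin n)) 1) :=
  ((volume : Measure (EuclideanSpace ℝ (Fin n))).toSphere Set.univ)⁻¹ •
    (volume : Measure (EuclideanSpace ℝ (Fin n))).toSphere

/-- The translation and rotation invariant measure on hyperplanes of `ℝⁿ` with intensity `γ`:
`Θ(A) = 2γ ∫_{S^{n-1}} ∫_0^∞ 1{H(u, τ) ∈ A} dτ σ(du)`, with `σ` uniform on the sphere. -/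
noncomputable def hyperplaneIntensity (n : ℕ) (γ : ℝ) : Measure (Hyperplane n) :=
  ENNReal.ofReal (2 * γ) •
    ((uniformSphere n).prod (volume.restrict (Set.Ici (0 : ℝ)))).map (hyperplaneOf n)

/-- `X` is a Poisson process on `S` with intensity measure `Θ`: a random counting measure such
that, for disjoint sets `A₁, …, A_k` of finite intensity, the counts `X(A₁), …, X(A_k)` are
independent and Poisson distributed with parameters `Θ(A₁), …, Θ(A_k)`. -/
structure IsPoissonProcess {Ω S : Type*} [MeasurableSpace Ω] [MeasurableSpace S]
    (P : Measure Ω) (X : Ω → Measure S) (Θ : Measure S) : Prop where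
  measurable : Measurable X
  counting : ∀ ω, ∃ (ι : Type) (_ : Countable ι) (h : ι → S),
    X ω = Measure.sum fun i => Measure.dirac (h i)
  poisson : ∀ (k : ℕ) (A : Fin k → Set S) (j : Fin k → ℕ),
    (∀ i, MeasurableSet (A i)) → Pairwise (Function.onFun Disjoint A) → (∀ i, Θ (A i) ≠ ∞) →
    P {ω | ∀ i, X ω (A i) = (j i : ℝ≥0∞)} =
      ∏ i, ENNReal.ofReal
        ((Θ (A i)).toReal ^ j i / (Nat.factorial (j i) : ℝ) * Real.exp (-(Θ (A i)).toReal))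

/-- `X` is a stationary and isotropic Poisson hyperplane process in `ℝⁿ` with intensity `γ`. -/
def IsStationaryIsotropicPoissonHyperplaneProcess {Ω : Type*} [MeasurableSpace Ω] {n : ℕ}
    (P : Measure Ω) (X : Ω → Measure (Hyperplane n)) (γ : ℝ) : Prop :=
  IsPoissonProcess P X (hyperplaneIntensity n γ)

/-- The zero cell of the tessellation induced by the hyperplanes charged by the counting measure
`μ`: the closure of the component, containing the origin, of the complement of their union. -/
def zeroCell {n : ℕ} (μ : Measure (Hyperplane n)) : Set (EuclideanSpace ℝ (Fin n)) :=
  closure (connectedComponentIn (⋃ H ∈ {H : Hyperplane n | μ {H} ≠ 0}, H.carrier)ᶜ 0)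

/-- `R_M(C) = inf {r > 0 | C ⊆ B(r)}`, with value `∞` if `C` is unbounded. -/
noncomputable def circumradius {n : ℕ} (C : Set (EuclideanSpace ℝ (Fin n))) : ℝ≥0∞ :=
  ⨅ r ∈ {r : ℝ | 0 < r ∧ C ⊆ Metric.closedBall 0 r}, ENNReal.ofReal r

/-! ### Uniform measure on the sphere: caps, rotation invariance, second moment. -/

section SphereMeasure

open scoped Pointwise

/-! Put `s = n^(3/2-α) R`. A unit normal typically has inner product of order `1/√n` with a fixed
direction, so the hyperplanes that matter at radius `s` are those at distance of order `s/√n` from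
the origin. Their expected number is of order `γ s/√n`, that is `ρ R m`. Both thresholds compare
this number with `m = dim L`, the entropy of the unit sphere of `L`.

Small radius (`exists_measure_norm_gt_le`). If `x ∈ L` lies in the cell and `‖x‖ > s`, put `v =
x/‖x‖`; every hyperplane at distance at most `s/(4√n)` has `√n⟨u,v⟩ ≤ 1/4`. For every `w` of a net
with at most `D^m` points, a fixed proportion of these hyperplanes has `√n⟨u,w⟩ ≥ 1/2`, so the sum
of `√n|⟨u,w-v⟩|` over them is large. But this sum is a seminorm of `w-v`, and a bound on the net
extends to the whole sphere, so it is small once `w` is close to `v`. The mesh is therefore an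
absolute constant rather than `1/√n`, and no factor `n^(m/2)` appears. Poisson tails give failure
probability at most `2 D^m exp(-cγs/√n)`, up to constants in the exponent.

Large radius (`exists_measure_circumradius_le`). A point of `L` of norm at least `s` with `|⟨u_i,x⟩|
< τ_i` for all hyperplanes is found by the entropy method. Round the inner products of the points of
a sphere with the projected normals, in units of the distances. If the rounding pattern has small
expected code length, some pattern has more mass than a cap, hence contains two points at distance
at least one; their difference, rescaled, is the required point (`exists_abs_inner_lt`). The code
length is bounded by a sum over the process, and an exponential moment bounds that sum when `ρ` is
small.

The random subspace is replaced by finitely many deterministic ones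
(`measure_le_of_forall_subspaceNear`). -/

/-- The uniform probability measure on the unit sphere of a Euclidean space. -/
noncomputable def usphere (F : Type*) [NormedAddCommGroup F] [InnerProductSpace ℝ F]
    [FiniteDimensional ℝ F] [MeasurableSpace F] [BorelSpace F] :
    Measure (Metric.sphere (0 : F) 1) :=
  ((volume : Measure F).toSphere Set.univ)⁻¹ • (volume : Measure F).toSphere

theorem uniformSphere_eq_usphere (n : ℕ) :
    uniformSphere n = usphere (EuclideanSpace ℝ (Fin n)) := rfl

variable {F : Type*} [NormedAddCommGroup F] [InnerProductSpace ℝ F]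
  [FiniteDimensional ℝ F] [MeasurableSpace F] [BorelSpace F]

instance [Nontrivial F] : IsProbabilityMeasure (usphere F) where
  measure_univ := by
    have h0 : (volume : Measure F).toSphere Set.univ ≠ 0 := by
      rw [Ne, Measure.measure_univ_eq_zero]
      exact Measure.toSphere_ne_zero _
    simp only [usphere, Measure.smul_apply, smul_eq_mul]
    exact ENNReal.inv_mul_cancel h0 (measure_ne_top _ _)

theorem usphere_apply [Nontrivial F] {s : Set (Metric.sphere (0 : F) 1)} (hs : MeasurableSet s) :
    usphere F s = (volume (Metric.ball (0 : F) 1))⁻¹ *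
      volume (Set.Ioo (0 : ℝ) 1 • ((↑) '' s : Set F)) := by
  have hd : (Module.finrank ℝ F : ℝ≥0∞) ≠ 0 := by
    exact_mod_cast Module.finrank_pos.ne'
  simp only [usphere, Measure.smul_apply, smul_eq_mul, Measure.toSphere_apply_univ,
    Measure.toSphere_apply' _ hs]
  rw [ENNReal.mul_inv (Or.inl hd) (Or.inl (ENNReal.natCast_ne_top _))]
  calc _ = ((Module.finrank ℝ F : ℝ≥0∞)⁻¹ * (Module.finrank ℝ F : ℝ≥0∞)) *
        ((volume (Metric.ball (0 : F) 1))⁻¹ *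
      volume (Set.Ioo (0 : ℝ) 1 • ((↑) '' s : Set F))) := by ring
    _ = _ := by
      rw [ENNReal.inv_mul_cancel hd (ENNReal.natCast_ne_top _), one_mul]

theorem measurable_inner_sphere (w : F) :
    Measurable fun u : Metric.sphere (0 : F) 1 => inner ℝ (u : F) w := by
  fun_prop

/-- The cone over the cap lies in the ball of centre `(t/2)w` and radius `√(1 - 3t²/4)`; the measure
is at most the volume ratio. The centre `(t/2)w`, rather than `tw`, makes this work for every `t ≤
1`. -/
theorem usphere_cap_le [Nontrivial F] {w : F} (hw : ‖w‖ = 1) {t : ℝ} (ht : 0 ≤ t) :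
    usphere F {u | t ≤ inner ℝ (u : F) w} ≤
      ENNReal.ofReal (Real.exp (-(3 / 8) * Module.finrank ℝ F * t ^ 2)) := by
  have hms : MeasurableSet {u : Metric.sphere (0 : F) 1 | t ≤ inner ℝ (u : F) w} :=
    measurableSet_le measurable_const (measurable_inner_sphere w)
  by_cases ht1 : 1 < t
  · have : {u : Metric.sphere (0 : F) 1 | t ≤ inner ℝ (u : F) w} = ∅ := by
      ext u
      simp only [Set.mem_ofPred_eq, Set.mem_empty_iff_false, iff_false, not_le]
      have h := real_inner_le_norm (u : F) w
      rw [hw, norm_eq_of_mem_sphere u] at h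
      linarith
    simp [this]
  push Not at ht1
  set ρ : ℝ := Real.sqrt (1 - 3 / 4 * t ^ 2) with hρ
  have hnn : 0 ≤ 1 - 3 / 4 * t ^ 2 := by nlinarith
  have hρ0 : 0 ≤ ρ := Real.sqrt_nonneg _
  have hsub : Set.Ioo (0 : ℝ) 1 •
      ((↑) '' {u : Metric.sphere (0 : F) 1 | t ≤ inner ℝ (u : F) w} : Set F) ⊆
      Metric.closedBall ((t / 2) • w) ρ := by
    rintro _ ⟨a, ⟨ha0, ha1⟩, _, ⟨u, hu, rfl⟩, rfl⟩
    simp only [Set.mem_ofPred_eq] at hu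
    rw [Metric.mem_closedBall, dist_eq_norm]
    apply Real.le_sqrt_of_sq_le
    have hun : ‖(u : F)‖ = 1 := norm_eq_of_mem_sphere u
    have : ‖a • (u : F) - (t / 2) • w‖ ^ 2 =
        a ^ 2 - a * t * inner ℝ (u : F) w + t ^ 2 / 4 := by
      rw [norm_sub_sq_real, norm_smul, norm_smul, hun, hw, real_inner_smul_left,
        real_inner_smul_right]
      simp only [Real.norm_eq_abs, mul_one, sq_abs]
      ring
    beta_reduce
    rw [this]
    have h1 : a * t * t ≤ a * t * inner ℝ (u : F) w :=
      mul_le_mul_of_nonneg_left hu (by positivity)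
    -- The bound `a² - at² + t²/4` is convex in `a`, so only `a = 0` and `a = 1` matter; both give
    -- at most `1 - 3t²/4`.
    nlinarith [mul_nonneg ha0.le (sub_nonneg.2 ha1.le), mul_nonneg (mul_nonneg ht ht) ha0.le,
      mul_nonneg (sub_nonneg.2 ha1.le) (sub_nonneg.2 ht1),
      mul_nonneg ht (mul_nonneg (sub_nonneg.2 ha1.le) (sub_nonneg.2 ht1)),
      mul_nonneg ht (sub_nonneg.2 ht1)]
  rw [usphere_apply hms]
  have hvol : volume (Metric.closedBall ((t / 2) • w) ρ) =
      ENNReal.ofReal (ρ ^ Module.finrank ℝ F) * volume (Metric.ball (0 : F) 1) :=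
    Measure.addHaar_closedBall _ _ hρ0
  calc _ ≤ (volume (Metric.ball (0 : F) 1))⁻¹ *
        (ENNReal.ofReal (ρ ^ Module.finrank ℝ F) * volume (Metric.ball (0 : F) 1)) := by
        rw [← hvol]; gcongr
    _ = ENNReal.ofReal (ρ ^ Module.finrank ℝ F) := by
        rw [mul_comm, mul_assoc, ENNReal.mul_inv_cancel
          (Metric.measure_ball_pos _ _ one_pos).ne' measure_ball_lt_top.ne, mul_one]
    _ ≤ _ := by
        apply ENNReal.ofReal_le_ofReal
        have h2 : ρ ≤ Real.exp (-(3 / 8) * t ^ 2) := by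
          rw [hρ, Real.sqrt_le_left (Real.exp_pos _).le, ← Real.exp_nat_mul]
          have := Real.add_one_le_exp ((2 : ℕ) * (-(3 / 8) * t ^ 2))
          push_cast at this ⊢
          linarith
        calc ρ ^ Module.finrank ℝ F ≤ Real.exp (-(3 / 8) * t ^ 2) ^ Module.finrank ℝ F := by
              gcongr
          _ = _ := by rw [← Real.exp_nat_mul]; congr 1; ring

/-- The reflection in the hyperplane orthogonal to `v - w` carries `v` to `w` and preserves volume.
-/
theorem usphere_inner_mem_eq [Nontrivial F] {v w : F} (h : ‖v‖ = ‖w‖) {B : Set ℝ}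
    (hB : MeasurableSet B) :
    usphere F {u | inner ℝ (u : F) v ∈ B} = usphere F {u | inner ℝ (u : F) w ∈ B} := by
  obtain ⟨T, hT⟩ : ∃ T : F ≃ₗᵢ[ℝ] F, T v = w :=
    ⟨(Submodule.span ℝ {v - w})ᗮ.reflection, Submodule.reflection_sub h⟩
  have hm : ∀ z : F, MeasurableSet {u : Metric.sphere (0 : F) 1 | inner ℝ (u : F) z ∈ B} :=
    fun z => measurable_inner_sphere z hB
  rw [usphere_apply (hm v), usphere_apply (hm w)]
  congr 1
  have : (Set.Ioo (0 : ℝ) 1 • ((↑) '' {u : Metric.sphere (0 : F) 1 | inner ℝ (u : F) v ∈ B}) : Set F)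
      = T ⁻¹' (Set.Ioo (0 : ℝ) 1 •
        ((↑) '' {u : Metric.sphere (0 : F) 1 | inner ℝ (u : F) w ∈ B})) := by
    ext x
    constructor
    · rintro ⟨a, ha, _, ⟨u, hu, rfl⟩, rfl⟩
      refine ⟨a, ha, T u, ⟨⟨T u, ?_⟩, ?_, rfl⟩, by simp⟩
      · simp
      · simpa [← hT] using hu
    · rintro ⟨a, ha, _, ⟨u, hu, rfl⟩, hx⟩
      refine ⟨a, ha, T.symm u, ⟨⟨T.symm u, ?_⟩, ?_, rfl⟩, ?_⟩
      · simp
      · simp only [Set.mem_ofPred_eq, ← hT] at hu ⊢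
        rwa [← T.inner_map_map, T.apply_symm_apply]
      · apply T.injective
        simpa using hx
  rw [this]
  exact T.measurePreserving.measure_preimage_equiv (f := T.toMeasurableEquiv) _

theorem map_inner_usphere_eq [Nontrivial F] {v w : F} (h : ‖v‖ = ‖w‖) :
    (usphere F).map (fun u : Metric.sphere (0 : F) 1 => inner ℝ (u : F) v) =
      (usphere F).map (fun u : Metric.sphere (0 : F) 1 => inner ℝ (u : F) w) := by
  ext B hB
  rw [Measure.map_apply (measurable_inner_sphere v) hB,
    Measure.map_apply (measurable_inner_sphere w) hB]
  exact usphere_inner_mem_eq h hB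

theorem lintegral_usphere_inner_eq [Nontrivial F] {v w : F} (h : ‖v‖ = ‖w‖) {f : ℝ → ℝ≥0∞}
    (hf : Measurable f) :
    ∫⁻ u, f (inner ℝ (u : F) v) ∂usphere F = ∫⁻ u, f (inner ℝ (u : F) w) ∂usphere F := by
  rw [← lintegral_map hf (measurable_inner_sphere v), map_inner_usphere_eq h,
    lintegral_map hf (measurable_inner_sphere w)]

/-- By invariance all directions of length `‖y‖` contribute equally, and over an orthonormal basis
the contributions sum to `‖y‖²`. -/
theorem lintegral_usphere_inner_sq [Nontrivial F] (y : F) :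
    ∫⁻ u, ENNReal.ofReal (inner ℝ (u : F) y ^ 2) ∂usphere F =
      ENNReal.ofReal (‖y‖ ^ 2 / Module.finrank ℝ F) := by
  have hd : (0 : ℝ) < Module.finrank ℝ F := by exact_mod_cast Module.finrank_pos
  set b := stdOrthonormalBasis ℝ F
  have hsum : ∑ i, ∫⁻ u, ENNReal.ofReal (inner ℝ (u : F) (‖y‖ • b i) ^ 2) ∂usphere F =
      ENNReal.ofReal (‖y‖ ^ 2) := by
    rw [← lintegral_finsetSum _ (fun i _ => by fun_prop)]
    have : ∀ u : Metric.sphere (0 : F) 1,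
        ∑ i, ENNReal.ofReal (inner ℝ (u : F) (‖y‖ • b i) ^ 2) = ENNReal.ofReal (‖y‖ ^ 2) := by
      intro u
      rw [← ENNReal.ofReal_sum_of_nonneg (fun i _ => by positivity)]
      congr 1
      simp_rw [real_inner_smul_right, mul_pow, ← Finset.mul_sum]
      have := b.sum_sq_norm_inner_left (u : F)
      simp only [Real.norm_eq_abs, sq_abs, norm_eq_of_mem_sphere u] at this
      rw [this]; ring
    simp [this]
  have heq : ∀ i, ∫⁻ u, ENNReal.ofReal (inner ℝ (u : F) (‖y‖ • b i) ^ 2) ∂usphere F =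
      ∫⁻ u, ENNReal.ofReal (inner ℝ (u : F) y ^ 2) ∂usphere F := fun i =>
    lintegral_usphere_inner_eq (f := fun x => ENNReal.ofReal (x ^ 2))
      (by rw [norm_smul, b.norm_eq_one]; simp) (by fun_prop)
  simp_rw [heq] at hsum
  rw [Finset.sum_const, Finset.card_univ, Fintype.card_fin, nsmul_eq_mul] at hsum
  rw [ENNReal.ofReal_div_of_pos hd, ← hsum, ENNReal.ofReal_natCast, mul_comm,
    ENNReal.mul_div_cancel_right]
  · exact_mod_cast Module.finrank_pos.ne'
  · exact ENNReal.natCast_ne_top _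

end SphereMeasure

/-! ### Dimension-free moments and a lower bound for caps of height `1/(2√d)`. -/

section SphereMoments

/-- A dimension-free bound for the exponential moments of squared coordinates on spheres. -/
noncomputable def sphereExpConst : ℝ := 2 * Real.exp (1 / 8) / (1 - Real.exp (-(1 / 4)))

theorem one_le_sphereExpConst : 1 ≤ sphereExpConst := by
  have h1 : Real.exp (-(1 / 4)) < 1 := by rw [Real.exp_lt_one_iff]; norm_num
  have h2 := Real.exp_pos (-(1 / 4))
  have h3 : 1 ≤ Real.exp (1 / 8) := Real.one_le_exp (by norm_num)
  rw [sphereExpConst, le_div_iff₀ (by linarith)]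
  linarith

variable {F : Type*} [NormedAddCommGroup F] [InnerProductSpace ℝ F]
  [FiniteDimensional ℝ F] [MeasurableSpace F] [BorelSpace F]

theorem usphere_abs_cap_le [Nontrivial F] {w : F} (hw : ‖w‖ = 1) {t : ℝ} (ht : 0 ≤ t) :
    usphere F {u | t ≤ |inner ℝ (u : F) w|} ≤
      2 * ENNReal.ofReal (Real.exp (-(3 / 8) * Module.finrank ℝ F * t ^ 2)) := by
  have hsub : {u : Metric.sphere (0 : F) 1 | t ≤ |inner ℝ (u : F) w|} ⊆
      {u | t ≤ inner ℝ (u : F) w} ∪ {u | t ≤ inner ℝ (u : F) (-w)} := by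
    intro u hu
    simp only [Set.mem_ofPred_eq, Set.mem_union, inner_neg_right] at hu ⊢
    exact le_abs.1 hu
  refine (measure_mono hsub).trans ((measure_union_le _ _).trans ?_)
  rw [two_mul]
  exact add_le_add (usphere_cap_le hw ht) (usphere_cap_le (by rwa [norm_neg]) ht)

/-- Slice by the integer part `k` of `d⟨u,w⟩²`: the integrand is at most `exp((k+1)/8)` and the tail
at most `2 exp(-3k/8)`, which leaves a geometric series of ratio `exp(-1/4)`. -/
theorem lintegral_usphere_exp_sq_le [Nontrivial F] {w : F} (hw : ‖w‖ = 1) :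
    ∫⁻ u, ENNReal.ofReal (Real.exp (Module.finrank ℝ F * inner ℝ (u : F) w ^ 2 / 8)) ∂usphere F ≤
      ENNReal.ofReal sphereExpConst := by
  set d : ℝ := (Module.finrank ℝ F : ℝ) with hd
  have hd0 : 0 < d := by rw [hd]; exact_mod_cast Module.finrank_pos
  set S : ℕ → Set (Metric.sphere (0 : F) 1) := fun k => {u | Real.sqrt (k / d) ≤ |inner ℝ (u : F) w|}
  have hS : ∀ k, MeasurableSet (S k) := fun k =>
    measurableSet_le measurable_const (measurable_inner_sphere w).abs
  have hpt : ∀ u : Metric.sphere (0 : F) 1,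
      ENNReal.ofReal (Real.exp (d * inner ℝ (u : F) w ^ 2 / 8)) ≤
      ∑' k : ℕ, (S k).indicator (fun _ => ENNReal.ofReal (Real.exp ((k + 1) / 8))) u := by
    intro u
    set x := d * inner ℝ (u : F) w ^ 2 with hx
    have hx0 : 0 ≤ x := by positivity
    refine le_trans ?_ (ENNReal.le_tsum ⌊x⌋₊)
    have hmem : u ∈ S ⌊x⌋₊ := by
      change Real.sqrt (⌊x⌋₊ / d) ≤ |inner ℝ (u : F) w|
      rw [← Real.sqrt_sq_eq_abs]
      apply Real.sqrt_le_sqrt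
      rw [div_le_iff₀ hd0, mul_comm]
      exact Nat.floor_le hx0
    rw [Set.indicator_of_mem hmem]
    apply ENNReal.ofReal_le_ofReal
    have := Nat.lt_floor_add_one x
    gcongr
  refine (lintegral_mono hpt).trans ?_
  rw [lintegral_tsum fun k => (measurable_const.indicator (hS k)).aemeasurable]
  simp_rw [lintegral_indicator_const (hS _)]
  have hterm : ∀ k : ℕ, ENNReal.ofReal (Real.exp ((k + 1) / 8)) * usphere F (S k) ≤
      ENNReal.ofReal (2 * Real.exp (1 / 8) * Real.exp (-(1 / 4)) ^ k) := by
    intro k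
    calc _ ≤ ENNReal.ofReal (Real.exp ((k + 1) / 8)) *
          (2 * ENNReal.ofReal (Real.exp (-(3 / 8) * d * Real.sqrt (k / d) ^ 2))) := by
          gcongr
          exact usphere_abs_cap_le hw (Real.sqrt_nonneg _)
      _ = _ := by
          rw [← ENNReal.ofReal_ofNat, ← ENNReal.ofReal_mul (by norm_num),
            ← ENNReal.ofReal_mul (Real.exp_pos _).le, Real.sq_sqrt (by positivity),
            ← Real.exp_nat_mul, mul_left_comm, mul_assoc 2, ← Real.exp_add, ← Real.exp_add]
          congr 3
          field_simp
          ring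
  refine (ENNReal.tsum_le_tsum hterm).trans ?_
  have hlt : Real.exp (-(1 / 4)) < 1 := by rw [Real.exp_lt_one_iff]; norm_num
  have hsum := (hasSum_geometric_of_lt_one (Real.exp_pos (-(1 / 4))).le hlt).mul_left
    (2 * Real.exp (1 / 8))
  rw [← ENNReal.ofReal_tsum_of_nonneg (fun k => by positivity) hsum.summable, hsum.tsum_eq]
  rfl

/-- A dimension-free lower bound for the measure of the caps of height `1 / (2 √d)`. -/
noncomputable def capConst : ℝ := 1 / (2048 * sphereExpConst)

theorem capConst_pos : 0 < capConst := by
  have := one_le_sphereExpConst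
  unfold capConst
  positivity

/-- The variable `x = d⟨u,w⟩²` has mean one. Values below `1/4` contribute at most `1/4`, and the
excess over `512C` at most `1/4` by the exponential moment. So the event `x ≥ 1/4` carries the
remaining half with height `512C`; by symmetry each of the two caps has half of its mass. -/
theorem capConst_le_usphere [Nontrivial F] {w : F} (hw : ‖w‖ = 1) :
    ENNReal.ofReal capConst ≤
      usphere F {u | 1 / 2 ≤ Real.sqrt (Module.finrank ℝ F) * inner ℝ (u : F) w} := by
  set d : ℝ := (Module.finrank ℝ F : ℝ) with hd
  have hd0 : 0 < d := by rw [hd]; exact_mod_cast Module.finrank_pos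
  have hC := one_le_sphereExpConst
  set C := sphereExpConst with hCdef
  set A : Set (Metric.sphere (0 : F) 1) := {u | 1 / 2 ≤ Real.sqrt d * inner ℝ (u : F) w} with hA
  set A' : Set (Metric.sphere (0 : F) 1) := {u | 1 / 2 ≤ Real.sqrt d * inner ℝ (u : F) (-w)} with hA'
  have hmA : ∀ z : F, MeasurableSet
      {u : Metric.sphere (0 : F) 1 | 1 / 2 ≤ Real.sqrt d * inner ℝ (u : F) z} := fun z =>
    measurableSet_le measurable_const ((measurable_inner_sphere z).const_mul _)
  have hAA' : usphere F A' = usphere F A := by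
    have := usphere_inner_mem_eq (v := -w) (w := w) (norm_neg w)
      (B := {x | 1 / 2 ≤ Real.sqrt d * x}) (measurableSet_le measurable_const (by fun_prop))
    exact this
  have hpt : ∀ u : Metric.sphere (0 : F) 1, ENNReal.ofReal (d * inner ℝ (u : F) w ^ 2) ≤
      ENNReal.ofReal (1 / 4) + (A ∪ A').indicator (fun _ => ENNReal.ofReal (512 * C)) u +
        ENNReal.ofReal (1 / (4 * C)) *
          ENNReal.ofReal (Real.exp (d * inner ℝ (u : F) w ^ 2 / 8)) := by
    intro u
    set x := d * inner ℝ (u : F) w ^ 2 with hx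
    have hx0 : 0 ≤ x := by positivity
    have hexp : x ^ 2 / 128 ≤ Real.exp (x / 8) := by
      have := Real.quadratic_le_exp_of_nonneg (show 0 ≤ x / 8 by positivity)
      nlinarith
    have hsq : (Real.sqrt d * inner ℝ (u : F) w) ^ 2 = x := by
      rw [mul_pow, Real.sq_sqrt hd0.le]
    rw [← ENNReal.ofReal_mul (by positivity)]
    by_cases h1 : x ≤ 1 / 4
    · exact (ENNReal.ofReal_le_ofReal h1).trans (by rw [add_assoc]; exact le_self_add)
    push Not at h1
    have hmem : u ∈ A ∪ A' := by
      by_contra hcon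
      have ha : ¬ (1 / 2 ≤ Real.sqrt d * inner ℝ (u : F) w) := fun h => hcon (Or.inl h)
      have hb : ¬ (1 / 2 ≤ Real.sqrt d * inner ℝ (u : F) (-w)) := fun h => hcon (Or.inr h)
      rw [inner_neg_right] at hb
      nlinarith
    rw [Set.indicator_of_mem hmem, ← ENNReal.ofReal_add (by positivity) (by positivity),
      ← ENNReal.ofReal_add (by positivity) (by positivity)]
    apply ENNReal.ofReal_le_ofReal
    have h2 : 1 / (4 * C) * (x ^ 2 / 128) ≤ 1 / (4 * C) * Real.exp (x / 8) := by gcongr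
    have h3 : x ≤ 512 * C + 1 / (4 * C) * (x ^ 2 / 128) := by
      have : 512 * C + 1 / (4 * C) * (x ^ 2 / 128) - x =
        (1 / (512 * C)) * ((512 * C - x) ^ 2 + 512 * C * x) := by
        field_simp; ring
      have h4 : 0 ≤ (1 / (512 * C)) * ((512 * C - x) ^ 2 + 512 * C * x) := by positivity
      linarith
    linarith
  have hint := lintegral_mono (μ := usphere F) hpt
  have hone : ∫⁻ u, ENNReal.ofReal (d * inner ℝ (u : F) w ^ 2) ∂usphere F = 1 := by
    simp_rw [ENNReal.ofReal_mul hd0.le]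
    rw [lintegral_const_mul _ (by fun_prop), lintegral_usphere_inner_sq, hw,
      ← ENNReal.ofReal_mul hd0.le, ← hd, one_pow, mul_one_div_cancel hd0.ne', ENNReal.ofReal_one]
  have hmU : MeasurableSet (A ∪ A') := (hmA w).union (hmA (-w))
  rw [hone, lintegral_add_right _ (by fun_prop), lintegral_add_right _
    (measurable_const.indicator hmU), lintegral_const, measure_univ, mul_one,
    lintegral_indicator_const hmU, lintegral_const_mul _ (by fun_prop)] at hint
  have hU : usphere F (A ∪ A') ≤ 2 * usphere F A := by
    refine (measure_union_le _ _).trans ?_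
    rw [hAA', two_mul]
  have hE := lintegral_usphere_exp_sq_le hw
  rw [← hd, ← hCdef] at hE
  have hfin : usphere F A ≠ ∞ := measure_ne_top _ _
  have h5 : 1 ≤ ENNReal.ofReal (1 / 4) + ENNReal.ofReal (512 * C) *
      (2 * ENNReal.ofReal (usphere F A).toReal) + ENNReal.ofReal (1 / (4 * C)) * ENNReal.ofReal C := by
    rw [ENNReal.ofReal_toReal hfin]
    exact hint.trans (by gcongr)
  have hr0 : 0 ≤ (usphere F A).toReal := ENNReal.toReal_nonneg
  rw [← ENNReal.ofReal_ofNat, ← ENNReal.ofReal_mul (by norm_num),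
    ← ENNReal.ofReal_mul (by positivity), ← ENNReal.ofReal_mul (by positivity),
    ← ENNReal.ofReal_add (by positivity) (by positivity),
    ← ENNReal.ofReal_add (by positivity) (by positivity), ENNReal.one_le_ofReal] at h5
  rw [← ENNReal.ofReal_toReal hfin]
  apply ENNReal.ofReal_le_ofReal
  have h6 : 1 / (4 * C) * C = 1 / 4 := by field_simp
  rw [h6] at h5
  rw [capConst, ← hCdef, div_le_iff₀ (by positivity)]
  nlinarith

end SphereMoments

/-! ### Exponential moments and tails of sums over a Poisson process. -/

section PoissonTails

theorem lintegral_exp_mul_poissonMeasure (r : NNReal) (b : ℝ) :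
    ∫⁻ j, ENNReal.ofReal (Real.exp (b * (j : ℝ))) ∂poissonMeasure r =
      ENNReal.ofReal (Real.exp (r * (Real.exp b - 1))) := by
  rw [poissonMeasure, lintegral_sum_measure]
  simp_rw [lintegral_smul_measure, lintegral_dirac, smul_eq_mul]
  have hmul : ∀ n : ℕ, ENNReal.ofReal (Real.exp (-r) * (r : ℝ) ^ n / (Nat.factorial n : ℝ)) *
      ENNReal.ofReal (Real.exp (b * (n : ℝ))) = ENNReal.ofReal (Real.exp (-r) * (r : ℝ) ^ n /
        (Nat.factorial n : ℝ) * Real.exp (b * (n : ℝ))) := fun n =>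
    (ENNReal.ofReal_mul (by positivity)).symm
  rw [tsum_congr hmul]
  have hs : HasSum (fun n : ℕ => Real.exp (-r) * (r : ℝ) ^ n / (Nat.factorial n : ℝ) *
      Real.exp (b * n)) (Real.exp (r * (Real.exp b - 1))) := by
    have := (NormedSpace.expSeries_div_hasSum_exp ((r : ℝ) * Real.exp b)).mul_left (Real.exp (-r))
    rw [← Real.exp_eq_exp_ℝ, ← Real.exp_add] at this
    convert! this using 1
    · ext n
      rw [mul_pow, ← Real.exp_nat_mul, mul_comm b]
      ring
    · congr 1; ring
  rw [← ENNReal.ofReal_tsum_of_nonneg (fun n => by positivity) hs.summable, hs.tsum_eq]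

variable {Ω S : Type*} [MeasurableSpace Ω] [MeasurableSpace S] {P : Measure Ω}
  {X : Ω → Measure S} {Θ : Measure S}

theorem IsPoissonProcess.measurable_apply (hX : IsPoissonProcess P X Θ) {A : Set S}
    (hA : MeasurableSet A) : Measurable fun ω => X ω A :=
  (Measure.measurable_coe hA).comp hX.measurable

variable [IsProbabilityMeasure P]

/-- The point probabilities of the Poisson law add up to one, which excludes the value `∞` almost
surely; `counting` alone allows it. -/
theorem IsPoissonProcess.ae_eq_natCast (hX : IsPoissonProcess P X Θ) {A : Set S}
    (hA : MeasurableSet A) (hΘ : Θ A ≠ ∞) :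
    ∀ᵐ ω ∂P, ∃ j : ℕ, X ω A = (j : ℝ≥0∞) := by
  have hm := hX.measurable_apply hA
  have hmj : ∀ j : ℕ, MeasurableSet {ω | X ω A = (j : ℝ≥0∞)} := fun j =>
    hm (measurableSet_singleton _)
  have h1 : P (⋃ j : ℕ, {ω | X ω A = (j : ℝ≥0∞)}) = 1 := by
    rw [measure_iUnion _ hmj]
    · have : ∀ j : ℕ, P {ω | X ω A = (j : ℝ≥0∞)} =
          poissonMeasure (Θ A).toNNReal {j} := by
        intro j
        have := hX.poisson 1 (fun _ => A) (fun _ => j) (fun _ => hA)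
          (fun i k hik => (hik (Subsingleton.elim _ _)).elim) (fun _ => hΘ)
        simp only [forall_const, Finset.univ_unique, Finset.prod_const, Finset.card_singleton,
          pow_one] at this
        rw [this, poissonMeasure_singleton]
        congr 1
        rw [ENNReal.coe_toNNReal_eq_toReal]
        ring
      rw [tsum_congr this, ← measure_iUnion (fun i j hij => by simpa using hij)
        (fun _ => measurableSet_singleton _), Set.iUnion_of_singleton, measure_univ]
    · intro i j hij
      rw [Function.onFun, Set.disjoint_left]
      intro ω h1 h2
      simp only [Set.mem_ofPred_eq] at h1 h2
      rw [h1] at h2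
      exact hij (by exact_mod_cast h2)
  have h2 := (mem_ae_iff_prob_eq_one (MeasurableSet.iUnion hmj)).2 h1
  filter_upwards [h2] with ω hω
  exact Set.mem_iUnion.1 hω

theorem IsPoissonProcess.lintegral_exp_sum (hX : IsPoissonProcess P X Θ) {k : ℕ}
    (A : Fin k → Set S) (hA : ∀ i, MeasurableSet (A i))
    (hd : Pairwise (Function.onFun Disjoint A)) (hΘ : ∀ i, Θ (A i) ≠ ∞) (b : Fin k → ℝ) :
    ∫⁻ ω, ENNReal.ofReal (Real.exp (∑ i, b i * (X ω (A i)).toReal)) ∂P =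
      ENNReal.ofReal (Real.exp (∑ i, (Θ (A i)).toReal * (Real.exp (b i) - 1))) := by
  set N : Ω → Fin k → ℕ := fun ω i => ⌊(X ω (A i)).toReal⌋₊ with hN
  have hNm : Measurable N := measurable_pi_lambda _ fun i =>
    Nat.measurable_floor.comp (hX.measurable_apply (hA i)).ennreal_toReal
  have hae : ∀ᵐ ω ∂P, ∀ i, X ω (A i) = (N ω i : ℝ≥0∞) := by
    rw [ae_all_iff]
    intro i
    filter_upwards [hX.ae_eq_natCast (hA i) (hΘ i)] with ω ⟨j, hj⟩
    simp [hN, hj]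
  have hmap : P.map N = Measure.pi fun i => poissonMeasure (Θ (A i)).toNNReal := by
    refine Measure.ext_of_singleton fun j => ?_
    rw [Measure.map_apply hNm (measurableSet_singleton _), Measure.pi_singleton]
    have h1 : P (N ⁻¹' {j}) = P {ω | ∀ i, X ω (A i) = (j i : ℝ≥0∞)} := by
      apply measure_congr
      filter_upwards [hae] with ω hω
      apply propext
      change N ω = j ↔ ∀ i, X ω (A i) = (j i : ℝ≥0∞)
      simp only [hω, Nat.cast_inj, funext_iff]
    rw [h1, hX.poisson k A j hA hd hΘ]
    refine Finset.prod_congr rfl fun i _ => ?_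
    rw [poissonMeasure_singleton]
    congr 1
    rw [ENNReal.coe_toNNReal_eq_toReal]
    ring
  calc _ = ∫⁻ ω, ∏ i, ENNReal.ofReal (Real.exp (b i * (N ω i : ℝ))) ∂P := by
        refine lintegral_congr_ae ?_
        filter_upwards [hae] with ω hω
        rw [Real.exp_sum, ENNReal.ofReal_prod_of_nonneg fun i _ => (Real.exp_pos _).le]
        simp [hω]
    _ = ∫⁻ j, ∏ i, ENNReal.ofReal (Real.exp (b i * (j i : ℝ))) ∂(P.map N) := by
        rw [lintegral_map (measurable_of_countable _) hNm]
    _ = ∏ i, ∫⁻ j, ENNReal.ofReal (Real.exp (b i * (j : ℝ)))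
          ∂poissonMeasure (Θ (A i)).toNNReal := by
        rw [hmap, lintegral_prod_eq_prod_lintegral_of_indepFun Finset.univ
          (fun i (j : Fin k → ℕ) => ENNReal.ofReal (Real.exp (b i * (j i : ℝ))))
          (iIndepFun_pi (X := fun i (j : ℕ) => ENNReal.ofReal (Real.exp (b i * (j : ℝ))))
            fun i => (measurable_of_countable _).aemeasurable)
          fun i => measurable_of_countable _]
        refine Finset.prod_congr rfl fun i _ => ?_
        exact (measurePreserving_eval (fun i => poissonMeasure (Θ (A i)).toNNReal) i).lintegral_comp
          (f := fun j : ℕ => ENNReal.ofReal (Real.exp (b i * (j : ℝ)))) (measurable_of_countable _)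
    _ = _ := by
        simp_rw [lintegral_exp_mul_poissonMeasure]
        rw [Real.exp_sum, ENNReal.ofReal_prod_of_nonneg fun i _ => (Real.exp_pos _).le]
        rfl

theorem IsPoissonProcess.chernoff_sum (hX : IsPoissonProcess P X Θ) {k : ℕ}
    (A : Fin k → Set S) (hA : ∀ i, MeasurableSet (A i))
    (hd : Pairwise (Function.onFun Disjoint A)) (hΘ : ∀ i, Θ (A i) ≠ ∞) (b : Fin k → ℝ) (a : ℝ) :
    P {ω | a ≤ ∑ i, b i * (X ω (A i)).toReal} ≤
      ENNReal.ofReal (Real.exp ((∑ i, (Θ (A i)).toReal * (Real.exp (b i) - 1)) - a)) := by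
  have hm : Measurable fun ω => ∑ i, b i * (X ω (A i)).toReal :=
    Finset.measurable_sum _ fun i _ => (hX.measurable_apply (hA i)).ennreal_toReal.const_mul _
  have h := mul_meas_ge_le_lintegral (μ := P)
    (f := fun ω => ENNReal.ofReal (Real.exp (∑ i, b i * (X ω (A i)).toReal)))
    (Real.measurable_exp.comp hm).ennreal_ofReal (ENNReal.ofReal (Real.exp a))
  rw [hX.lintegral_exp_sum A hA hd hΘ b] at h
  rw [Real.exp_sub, ENNReal.ofReal_div_of_pos (Real.exp_pos _),
    ENNReal.le_div_iff_mul_le (Or.inl (by simp [Real.exp_pos])) (Or.inl ENNReal.ofReal_ne_top),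
    mul_comm]
  refine le_trans ?_ h
  gcongr
  intro hω
  exact ENNReal.ofReal_le_ofReal (Real.exp_le_exp.2 hω)

theorem IsPoissonProcess.lower_tail (hX : IsPoissonProcess P X Θ) {A : Set S}
    (hA : MeasurableSet A) {c : ℝ} (hc : 0 ≤ c) (hlow : ENNReal.ofReal (2 * c) ≤ Θ A)
    (hΘ : Θ A ≠ ∞) :
    P {ω | X ω A ≤ ENNReal.ofReal c} ≤ ENNReal.ofReal (Real.exp (-c / 5)) := by
  have h := hX.chernoff_sum (fun _ : Fin 1 => A) (fun _ => hA)
    (fun i k hik => (hik (Subsingleton.elim _ _)).elim) (fun _ => hΘ) (fun _ => -1) (-c)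
  simp only [Finset.univ_unique, Finset.sum_singleton] at h
  refine (measure_mono fun ω hω => ?_).trans (h.trans (ENNReal.ofReal_le_ofReal ?_))
  · have := ENNReal.toReal_le_of_le_ofReal hc hω
    change -c ≤ -1 * (X ω A).toReal
    linarith
  · apply Real.exp_le_exp.2
    have h2 : 2 * c ≤ (Θ A).toReal := (ENNReal.ofReal_le_iff_le_toReal hΘ).1 hlow
    -- With tilt `-1` the exponent is `Θ(A)(e⁻¹ - 1) + c`, at most `-(3/5)(2c) + c = -c/5`.
    have h3 : Real.exp (-1) ≤ 2 / 5 := by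
      rw [Real.exp_neg, inv_le_comm₀ (Real.exp_pos _) (by norm_num)]
      have := Real.exp_one_gt_d9
      norm_num at this ⊢
      linarith
    nlinarith

theorem IsPoissonProcess.upper_tail_simpleFunc (hX : IsPoissonProcess P X Θ) {A : Set S}
    (hΘ : Θ A ≠ ∞) (f : SimpleFunc S ℝ≥0∞) (hf : ∀ x, f x ≠ ∞)
    (hfA : ∀ x, x ∉ A → f x = 0) {a C : ℝ} (ha : 0 ≤ a) (hC0 : 0 ≤ C)
    (hC : ∫⁻ x, ENNReal.ofReal (Real.exp (f x).toReal - 1) ∂Θ ≤ ENNReal.ofReal C) :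
    P {ω | ENNReal.ofReal a < ∫⁻ x, f x ∂(X ω)} ≤ ENNReal.ofReal (Real.exp (C - a)) := by
  classical
  -- The level `0` is left out: its fibre may have infinite intensity, and the other fibres lie in
  -- `A`.
  set s := f.range.filter (· ≠ 0) with hs
  set e := s.equivFin.symm with he
  set B : Fin s.card → Set S := fun i => f ⁻¹' {(e i : ℝ≥0∞)} with hB
  have hBm : ∀ i, MeasurableSet (B i) := fun i => f.measurableSet_fiber _
  have hne : ∀ i, (e i : ℝ≥0∞) ≠ 0 := fun i => (Finset.mem_filter.1 (e i).2).2
  have hfin : ∀ i, (e i : ℝ≥0∞) ≠ ∞ := fun i => by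
    obtain ⟨x, hx⟩ := SimpleFunc.mem_range.1 (Finset.mem_filter.1 (e i).2).1
    rw [← hx]; exact hf x
  have hBΘ : ∀ i, Θ (B i) ≠ ∞ := fun i => by
    refine ne_top_of_le_ne_top hΘ (measure_mono fun x hx => ?_)
    by_contra hxA
    have : f x = e i := hx
    rw [hfA x hxA] at this
    exact hne i this.symm
  have hBd : Pairwise (Function.onFun Disjoint B) := fun i j hij => by
    rw [Function.onFun, Set.disjoint_left]
    intro x h1 h2
    have h1' : f x = e i := h1
    have h2' : f x = e j := h2
    exact hij (e.injective (Subtype.ext (h1'.symm.trans h2')))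
  have hsum : ∀ (μ : Measure S) (g : ℝ≥0∞ → ℝ≥0∞), g 0 = 0 →
      ∑ x ∈ f.range, g x * μ (f ⁻¹' {x}) = ∑ i, g (e i) * μ (B i) := by
    intro μ g hg
    rw [← Finset.sum_subset (Finset.filter_subset (· ≠ 0) f.range), ← Finset.sum_coe_sort,
      ← e.sum_comp]
    intro x hx hx'
    have : x = 0 := by
      by_contra h
      exact hx' (Finset.mem_filter.2 ⟨hx, h⟩)
    rw [this, hg, zero_mul]
  have hint : ∀ μ : Measure S, ∫⁻ x, f x ∂μ = ∑ i, (e i : ℝ≥0∞) * μ (B i) := by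
    intro μ
    rw [SimpleFunc.lintegral_eq_lintegral]
    exact hsum μ id rfl
  have hΘint : ∫⁻ x, ENNReal.ofReal (Real.exp (f x).toReal - 1) ∂Θ =
      ∑ i, ENNReal.ofReal (Real.exp (e i : ℝ≥0∞).toReal - 1) * Θ (B i) := by
    have := (f.map fun y => ENNReal.ofReal (Real.exp y.toReal - 1)).lintegral_eq_lintegral Θ
    simp only [SimpleFunc.map_apply] at this
    rw [← hsum Θ (fun y => ENNReal.ofReal (Real.exp y.toReal - 1)) (by simp),
      ← SimpleFunc.map_lintegral, ← this]
  have hexp : ∀ i, 0 ≤ Real.exp (e i : ℝ≥0∞).toReal - 1 := fun i =>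
    sub_nonneg.2 (Real.one_le_exp ENNReal.toReal_nonneg)
  have h1 : ∑ i, (Θ (B i)).toReal * (Real.exp (e i : ℝ≥0∞).toReal - 1) ≤ C := by
    rw [hΘint] at hC
    have := ENNReal.toReal_mono ENNReal.ofReal_ne_top hC
    rw [ENNReal.toReal_ofReal hC0, ENNReal.toReal_sum fun i _ =>
      ENNReal.mul_ne_top ENNReal.ofReal_ne_top (hBΘ i)] at this
    refine le_trans (le_of_eq (Finset.sum_congr rfl fun i _ => ?_)) this
    rw [ENNReal.toReal_mul, ENNReal.toReal_ofReal (hexp i), mul_comm]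
  refine le_trans ?_ ((hX.chernoff_sum B hBm hBd hBΘ (fun i => (e i : ℝ≥0∞).toReal) a).trans
    (ENNReal.ofReal_le_ofReal (Real.exp_le_exp.2 (sub_le_sub_right h1 a))))
  have hae : ∀ᵐ ω ∂P, ∀ i, X ω (B i) ≠ ∞ := by
    rw [ae_all_iff]
    intro i
    filter_upwards [hX.ae_eq_natCast (hBm i) (hBΘ i)] with ω ⟨j, hj⟩
    simp [hj]
  apply measure_mono_ae
  filter_upwards [hae] with ω hω h
  change ENNReal.ofReal a < ∫⁻ x, f x ∂(X ω) at h
  change a ≤ ∑ i, (e i : ℝ≥0∞).toReal * (X ω (B i)).toReal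
  have h2 : ∀ i ∈ Finset.univ, (e i : ℝ≥0∞) * X ω (B i) ≠ ∞ := fun i _ =>
    ENNReal.mul_ne_top (hfin i) (hω i)
  rw [hint] at h
  have h3 := (ENNReal.ofReal_lt_iff_lt_toReal ha (ENNReal.sum_ne_top.2 h2)).1 h
  rw [ENNReal.toReal_sum h2] at h3
  simp only [ENNReal.toReal_mul] at h3
  exact h3.le

theorem IsPoissonProcess.upper_tail (hX : IsPoissonProcess P X Θ) {A : Set S}
    (hΘ : Θ A ≠ ∞) {f : S → ℝ} (hfm : Measurable f)
    (hfA : ∀ x, x ∉ A → f x = 0) {a C : ℝ} (ha : 0 ≤ a) (hC0 : 0 ≤ C)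
    (hC : ∫⁻ x, ENNReal.ofReal (Real.exp (f x) - 1) ∂Θ ≤ ENNReal.ofReal C) :
    P {ω | ENNReal.ofReal a < ∫⁻ x, ENNReal.ofReal (f x) ∂(X ω)} ≤
      ENNReal.ofReal (Real.exp (C - a)) := by
  set g : S → ℝ≥0∞ := fun x => ENNReal.ofReal (f x) with hg
  have hgm : Measurable g := hfm.ennreal_ofReal
  set G := SimpleFunc.eapprox g with hG
  have hGle : ∀ n x, G n x ≤ g x := fun n x => by
    rw [← SimpleFunc.iSup_eapprox_apply hgm x]
    exact le_iSup (fun n => (G n) x) n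
  have hint : ∀ μ : Measure S, ∫⁻ x, g x ∂μ = ⨆ n, ∫⁻ x, G n x ∂μ := by
    intro μ
    rw [← lintegral_iSup (fun n => (G n).measurable)
      fun i j hij x => SimpleFunc.monotone_eapprox g hij x]
    exact lintegral_congr fun x => (SimpleFunc.iSup_eapprox_apply hgm x).symm
  -- The strict inequality makes the event the increasing union of the events of the approximants,
  -- so their common bound passes to the limit.
  have hset : {ω | ENNReal.ofReal a < ∫⁻ x, g x ∂(X ω)} =
      ⋃ n, {ω | ENNReal.ofReal a < ∫⁻ x, G n x ∂(X ω)} := by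
    ext ω
    simp only [Set.mem_ofPred_eq, Set.mem_iUnion, hint, lt_iSup_iff]
  have hmono : Monotone fun n => {ω | ENNReal.ofReal a < ∫⁻ x, G n x ∂(X ω)} := by
    intro i j hij ω hω
    exact lt_of_lt_of_le hω (lintegral_mono fun x => SimpleFunc.monotone_eapprox g hij x)
  rw [hset, hmono.measure_iUnion]
  refine iSup_le fun n => hX.upper_tail_simpleFunc hΘ (G n)
    (fun x => (SimpleFunc.eapprox_lt_top g n x).ne) (fun x hx => ?_) ha hC0
    (le_trans (lintegral_mono fun x => ?_) hC)
  · have := hGle n x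
    simpa [hg, hfA x hx] using this
  · by_cases h : 0 ≤ f x
    · apply ENNReal.ofReal_le_ofReal
      gcongr
      exact ENNReal.toReal_le_of_le_ofReal h (hGle n x)
    · have h0 : G n x = 0 := by
        have := hGle n x
        simpa [hg, ENNReal.ofReal_of_nonpos (not_le.1 h).le] using this
      simp [h0]

end PoissonTails

/-! ### Distances to hyperplanes, zero cell and circumradius. -/

section HyperplaneGeometry

variable {n : ℕ}

/-- The distance from a point to a hyperplane. -/
noncomputable def Hyperplane.dist (H : Hyperplane n) (x : EuclideanSpace ℝ (Fin n)) : ℝ :=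
  Metric.infDist x H.carrier

theorem Hyperplane.ext' {H K : Hyperplane n} (h : H.carrier = K.carrier) : H = K := by
  cases H; cases K; simpa using h

theorem norm_coe_sphere (u : Metric.sphere (0 : EuclideanSpace ℝ (Fin n)) 1) :
    ‖(u : EuclideanSpace ℝ (Fin n))‖ = 1 := norm_eq_of_mem_sphere u

theorem foot_mem_hyperplaneOf (p : Metric.sphere (0 : EuclideanSpace ℝ (Fin n)) 1 × ℝ)
    (x : EuclideanSpace ℝ (Fin n)) :
    x - (inner ℝ x (p.1 : EuclideanSpace ℝ (Fin n)) - p.2) • (p.1 : EuclideanSpace ℝ (Fin n)) ∈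
      (hyperplaneOf n p).carrier := by
  change inner ℝ _ _ = _
  rw [inner_sub_left, real_inner_smul_left, real_inner_self_eq_norm_sq, norm_coe_sphere]
  ring

theorem dist_hyperplaneOf (p : Metric.sphere (0 : EuclideanSpace ℝ (Fin n)) 1 × ℝ)
    (x : EuclideanSpace ℝ (Fin n)) :
    (hyperplaneOf n p).dist x = |inner ℝ x (p.1 : EuclideanSpace ℝ (Fin n)) - p.2| := by
  apply le_antisymm
  · refine (Metric.infDist_le_dist_of_mem (foot_mem_hyperplaneOf p x)).trans (le_of_eq ?_)
    rw [dist_eq_norm, sub_sub_cancel, norm_smul, norm_coe_sphere, mul_one, Real.norm_eq_abs]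
  · refine (Metric.le_infDist ⟨_, foot_mem_hyperplaneOf p x⟩).2 fun y hy => ?_
    have hy' : inner ℝ y (p.1 : EuclideanSpace ℝ (Fin n)) = p.2 := hy
    rw [← hy', ← inner_sub_left, dist_eq_norm]
    simpa [norm_coe_sphere] using abs_real_inner_le_norm (x - y) (p.1 : EuclideanSpace ℝ (Fin n))

theorem Hyperplane.exists_rep (H : Hyperplane n) :
    ∃ p : Metric.sphere (0 : EuclideanSpace ℝ (Fin n)) 1 × ℝ, 0 ≤ p.2 ∧ hyperplaneOf n p = H := by
  obtain ⟨u, hu, τ, h⟩ := H.exists_eq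
  rcases le_total 0 τ with hτ | hτ
  · exact ⟨(⟨u, hu⟩, τ), hτ, Hyperplane.ext' h.symm⟩
  · refine ⟨(⟨-u, by simpa using hu⟩, -τ), by simpa using hτ, Hyperplane.ext' ?_⟩
    rw [h]
    ext x
    change inner ℝ x (-u) = -τ ↔ inner ℝ x u = τ
    rw [inner_neg_right, neg_inj]

theorem Hyperplane.exists_mem_dist_eq (H : Hyperplane n) (x : EuclideanSpace ℝ (Fin n)) :
    ∃ y ∈ H.carrier, Dist.dist y x = H.dist x := by
  obtain ⟨p, -, rfl⟩ := H.exists_rep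
  refine ⟨_, foot_mem_hyperplaneOf p x, ?_⟩
  rw [dist_hyperplaneOf, dist_eq_norm, sub_sub_cancel_left, norm_neg, norm_smul, norm_coe_sphere,
    mul_one, Real.norm_eq_abs]

/-- The distance is attained, so a sublevel set consists of the hyperplanes that hit a closed ball,
one of the generators of the σ-algebra. All other functions of hyperplanes below are built from such
distances to be measurable. -/
theorem measurable_hyperplane_dist (x : EuclideanSpace ℝ (Fin n)) :
    Measurable fun H : Hyperplane n => H.dist x := by
  refine measurable_of_Iic fun r => MeasurableSpace.measurableSet_generateFrom
    ⟨Metric.closedBall x r, isCompact_closedBall x r, ?_⟩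
  ext H
  constructor
  · intro h
    obtain ⟨y, hy, hyx⟩ := H.exists_mem_dist_eq x
    exact ⟨y, hy, Metric.mem_closedBall.2 (hyx.trans_le h)⟩
  · rintro ⟨y, hy, hyx⟩
    exact (Metric.infDist_le_dist_of_mem hy).trans (by rw [dist_comm]; exact hyx)

/-- The absolute value of the inner product of a point with a unit normal of a hyperplane. -/
noncomputable def Hyperplane.absInner (H : Hyperplane n) (x : EuclideanSpace ℝ (Fin n)) : ℝ :=
  max (H.dist x) (H.dist (-x)) - H.dist 0

theorem measurable_absInner (x : EuclideanSpace ℝ (Fin n)) :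
    Measurable fun H : Hyperplane n => H.absInner x :=
  ((measurable_hyperplane_dist x).max (measurable_hyperplane_dist (-x))).sub
    (measurable_hyperplane_dist 0)

theorem dist_zero_hyperplaneOf {p : Metric.sphere (0 : EuclideanSpace ℝ (Fin n)) 1 × ℝ}
    (hp : 0 ≤ p.2) : (hyperplaneOf n p).dist 0 = p.2 := by
  rw [dist_hyperplaneOf, inner_zero_left, zero_sub, abs_neg, abs_of_nonneg hp]

/-- For `τ ≥ 0` and real `a`, `max |a - τ| |a + τ| = |a| + τ`. -/
theorem absInner_hyperplaneOf {p : Metric.sphere (0 : EuclideanSpace ℝ (Fin n)) 1 × ℝ}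
    (hp : 0 ≤ p.2) (x : EuclideanSpace ℝ (Fin n)) :
    (hyperplaneOf n p).absInner x = |inner ℝ (p.1 : EuclideanSpace ℝ (Fin n)) x| := by
  rw [Hyperplane.absInner, dist_zero_hyperplaneOf hp, dist_hyperplaneOf, dist_hyperplaneOf,
    inner_neg_left, real_inner_comm]
  rcases le_total 0 (inner ℝ (p.1 : EuclideanSpace ℝ (Fin n)) x) with h | h
  · rw [abs_of_nonneg h, max_eq_right, abs_of_nonpos] <;>
    first
    | linarith
    | (rw [abs_le, abs_of_nonpos (by linarith)]; constructor <;> linarith)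
  · rw [abs_of_nonpos h, max_eq_left, abs_of_nonpos] <;>
    first
    | linarith
    | (rw [abs_le, abs_of_nonpos (by linarith)]; constructor <;> linarith)

theorem lintegral_hyperplaneIntensity (γ : ℝ) {f : Hyperplane n → ℝ≥0∞} (hf : Measurable f) :
    ∫⁻ H, f H ∂hyperplaneIntensity n γ = ENNReal.ofReal (2 * γ) *
      ∫⁻ u, (∫⁻ τ in Set.Ici (0 : ℝ), f (hyperplaneOf n (u, τ))) ∂uniformSphere n := by
  have : SFinite (uniformSphere n) := by unfold uniformSphere; infer_instance
  rw [hyperplaneIntensity, lintegral_smul_measure, smul_eq_mul,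
    lintegral_map hf (measurable_hyperplaneOf n),
    lintegral_prod (fun a => f (hyperplaneOf n a)) (hf.comp (measurable_hyperplaneOf n)).aemeasurable]

/-- Measurability of `{H}` is not needed: the distance functions are measurable and separate
hyperplanes, so a Dirac mass at another hyperplane does not charge `{H}`. -/
theorem exists_eq_of_sum_dirac_ne_zero {ι : Type} [Countable ι] (h : ι → Hyperplane n)
    {H : Hyperplane n} (hH : (Measure.sum fun i => Measure.dirac (h i)) {H} ≠ 0) :
    ∃ i, h i = H := by
  rw [Ne, Measure.sum_apply_eq_zero, not_forall] at hH
  obtain ⟨i, hi⟩ := hH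
  refine ⟨i, Hyperplane.ext' ?_⟩
  have hd : ∀ x, (h i).dist x = H.dist x := by
    intro x
    by_contra hne
    have hm : MeasurableSet {K : Hyperplane n | K.dist x = H.dist x} :=
      measurable_hyperplane_dist x (measurableSet_singleton _)
    apply hi
    refine measure_mono_null (t := {K : Hyperplane n | K.dist x = H.dist x})
      (Set.singleton_subset_iff.2 (by rfl)) ?_
    rw [Measure.dirac_apply' _ hm]
    exact Set.indicator_of_notMem (s := {K : Hyperplane n | K.dist x = H.dist x})
      (fun hc => hne hc) _
  have hmem : ∀ (K : Hyperplane n) x, x ∈ K.carrier ↔ K.dist x = 0 := by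
    intro K x
    constructor
    · intro hx
      exact Metric.infDist_zero_of_mem hx
    · intro hx
      obtain ⟨y, hy, hyx⟩ := K.exists_mem_dist_eq x
      rw [hx, dist_eq_zero] at hyx
      exact hyx ▸ hy
  ext x
  rw [hmem, hmem, hd]

theorem inner_le_of_mem_zeroCell {μ : Measure (Hyperplane n)}
    {p : Metric.sphere (0 : EuclideanSpace ℝ (Fin n)) 1 × ℝ} (hp : 0 < p.2)
    (hμ : μ {hyperplaneOf n p} ≠ 0) {x : EuclideanSpace ℝ (Fin n)} (hx : x ∈ zeroCell μ) :
    inner ℝ (p.1 : EuclideanSpace ℝ (Fin n)) x ≤ p.2 := by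
  set U := (⋃ H ∈ {H : Hyperplane n | μ {H} ≠ 0}, H.carrier)ᶜ with hU
  have hcl : IsClosed {x : EuclideanSpace ℝ (Fin n) |
      inner ℝ (p.1 : EuclideanSpace ℝ (Fin n)) x ≤ p.2} :=
    isClosed_le (by fun_prop) continuous_const
  refine closure_minimal (fun y hy => ?_) hcl hx
  -- If the origin lies on a charged hyperplane, `connectedComponentIn` is empty and there is
  -- nothing to show.
  have h0 : (0 : EuclideanSpace ℝ (Fin n)) ∈ U := by
    by_contra h
    rw [connectedComponentIn_eq_empty h] at hy
    exact hy
  by_contra hlt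
  change ¬ (inner ℝ (p.1 : EuclideanSpace ℝ (Fin n)) y ≤ p.2) at hlt
  push Not at hlt
  have hpre : IsPreconnected ((fun z => inner ℝ (p.1 : EuclideanSpace ℝ (Fin n)) z) ''
      connectedComponentIn U 0) :=
    isPreconnected_connectedComponentIn.image _ (by fun_prop)
  have hmem : p.2 ∈ (fun z => inner ℝ (p.1 : EuclideanSpace ℝ (Fin n)) z) ''
      connectedComponentIn U 0 := by
    refine hpre.Icc_subset ⟨0, mem_connectedComponentIn h0, rfl⟩ ⟨y, hy, rfl⟩ ⟨?_, hlt.le⟩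
    simpa using hp.le
  obtain ⟨z, hz, hzp⟩ := hmem
  have hzU := connectedComponentIn_subset U 0 hz
  apply hzU
  refine Set.mem_iUnion₂.2 ⟨hyperplaneOf n p, hμ, ?_⟩
  change inner ℝ z _ = _
  rw [real_inner_comm]
  exact hzp

/-- The segment from the origin to `x` misses every charged hyperplane. -/
theorem mem_zeroCell_of_absInner_lt {μ : Measure (Hyperplane n)} {x : EuclideanSpace ℝ (Fin n)}
    (h : ∀ H : Hyperplane n, μ {H} ≠ 0 → H.absInner x < H.dist 0) : x ∈ zeroCell μ := by
  refine subset_closure ?_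
  have hseg : segment ℝ 0 x ⊆ (⋃ H ∈ {H : Hyperplane n | μ {H} ≠ 0}, H.carrier)ᶜ := by
    intro y hy hyU
    obtain ⟨H, hH, hyH⟩ := Set.mem_iUnion₂.1 hyU
    have hlt := h H hH
    obtain ⟨p, hp, rfl⟩ := H.exists_rep
    rw [absInner_hyperplaneOf hp, dist_zero_hyperplaneOf hp] at hlt
    rw [segment_eq_image] at hy
    obtain ⟨θ, ⟨h0, h1⟩, rfl⟩ := hy
    have hy' : inner ℝ ((1 - θ) • (0 : EuclideanSpace ℝ (Fin n)) + θ • x)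
      (p.1 : EuclideanSpace ℝ (Fin n)) = p.2 := hyH
    rw [smul_zero, zero_add, real_inner_smul_left, real_inner_comm] at hy'
    have h2 : θ * inner ℝ (p.1 : EuclideanSpace ℝ (Fin n)) x ≤
        1 * |inner ℝ (p.1 : EuclideanSpace ℝ (Fin n)) x| :=
      (mul_le_mul_of_nonneg_left (le_abs_self _) h0).trans
        (mul_le_mul_of_nonneg_right h1 (abs_nonneg _))
    linarith
  exact (convex_segment 0 x).isPreconnected.subset_connectedComponentIn
    (left_mem_segment ℝ 0 x) hseg (right_mem_segment ℝ 0 x)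

theorem exists_norm_gt_of_le_circumradius {C : Set (EuclideanSpace ℝ (Fin n))} {r s : ℝ}
    (hs : 0 < s) (hsr : s < r) (h : ENNReal.ofReal r ≤ circumradius C) : ∃ x ∈ C, s < ‖x‖ := by
  by_contra hcon
  push Not at hcon
  have hle : circumradius C ≤ ENNReal.ofReal s :=
    iInf₂_le s ⟨hs, fun x hx => by simpa using hcon x hx⟩
  exact absurd (h.trans hle) (not_le.2 ((ENNReal.ofReal_lt_ofReal_iff (hs.trans hsr)).2 hsr))

theorem lt_circumradius_of_mem {C : Set (EuclideanSpace ℝ (Fin n))} {r : ℝ}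
    {x : EuclideanSpace ℝ (Fin n)} (hr : 0 < r) (hx : x ∈ C) (hxr : 2 * r ≤ ‖x‖) :
    ENNReal.ofReal r < circumradius C := by
  have hle : ENNReal.ofReal (2 * r) ≤ circumradius C := by
    refine le_iInf₂ fun s hs => ENNReal.ofReal_le_ofReal ?_
    have := hs.2 hx
    rw [mem_closedBall_zero_iff] at this
    linarith
  exact lt_of_lt_of_le ((ENNReal.ofReal_lt_ofReal_iff (by linarith)).2 (by linarith)) hle

end HyperplaneGeometry

/-! ### Intensity of wedges and exponential integrals of the weights. -/

section IntensityBounds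

variable {n : ℕ}

local notation "E" => EuclideanSpace ℝ (Fin n)

theorem lintegral_hyperplaneIntensity_le (γ : ℝ) {f : Hyperplane n → ℝ≥0∞} (hf : Measurable f)
    {a : ℝ → ℝ≥0∞} (ha : Measurable a) {b : Metric.sphere (0 : E) 1 → ℝ≥0∞} (hb : Measurable b)
    (h : ∀ u, ∀ τ, 0 ≤ τ → f (hyperplaneOf n (u, τ)) ≤ b u * a τ) :
    ∫⁻ H, f H ∂hyperplaneIntensity n γ ≤ ENNReal.ofReal (2 * γ) *
      ((∫⁻ u, b u ∂uniformSphere n) * ∫⁻ τ in Set.Ici (0 : ℝ), a τ) := by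
  rw [lintegral_hyperplaneIntensity γ hf]
  gcongr
  rw [← lintegral_mul_const _ hb]
  refine lintegral_mono fun u => ?_
  rw [← lintegral_const_mul _ ha]
  refine lintegral_mono_ae ?_
  filter_upwards [ae_restrict_mem measurableSet_Ici] with τ hτ
  exact h u τ hτ

theorem measurableSet_dist_zero_le (T : ℝ) : MeasurableSet {H : Hyperplane n | H.dist 0 ≤ T} :=
  measurable_hyperplane_dist 0 measurableSet_Iic

theorem volume_Ici_inter_Iic (T : ℝ) :
    ∫⁻ τ in Set.Ici (0 : ℝ), (Set.Iic T).indicator 1 τ = ENNReal.ofReal T := by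
  rw [lintegral_indicator_one measurableSet_Iic, Measure.restrict_apply measurableSet_Iic,
    Set.inter_comm, Set.Ici_inter_Iic, Real.volume_Icc, sub_zero]

variable [NeZero n]

instance : Nontrivial (EuclideanSpace ℝ (Fin n)) :=
  Module.nontrivial_of_finrank_pos (R := ℝ) (by
    rw [finrank_euclideanSpace_fin]; exact Nat.pos_of_ne_zero (NeZero.ne n))

instance : IsProbabilityMeasure (uniformSphere n) := by
  rw [uniformSphere_eq_usphere]; infer_instance

theorem hyperplaneIntensity_dist_le (γ T : ℝ) :
    hyperplaneIntensity n γ {H | H.dist 0 ≤ T} ≤ ENNReal.ofReal (2 * γ) * ENNReal.ofReal T := by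
  rw [← lintegral_indicator_one (measurableSet_dist_zero_le T)]
  refine (lintegral_hyperplaneIntensity_le γ (measurable_one.indicator
    (measurableSet_dist_zero_le T)) (a := (Set.Iic T).indicator 1) (b := fun _ => 1)
    (measurable_one.indicator measurableSet_Iic) measurable_const fun u τ hτ => ?_).trans ?_
  · rw [one_mul]
    simp only [Set.indicator, Set.mem_ofPred_eq, dist_zero_hyperplaneOf (p := (u, τ)) hτ,
      Set.mem_Iic]
    rfl
  · rw [lintegral_one, measure_univ, one_mul, volume_Ici_inter_Iic]

theorem hyperplaneIntensity_dist_ne_top (γ T : ℝ) :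
    hyperplaneIntensity n γ {H | H.dist 0 ≤ T} ≠ ∞ :=
  ne_top_of_le_ne_top (ENNReal.mul_ne_top ENNReal.ofReal_ne_top ENNReal.ofReal_ne_top)
    (hyperplaneIntensity_dist_le γ T)

/-- The hyperplanes at distance in `(0, T]` from the origin whose unit normal pointing away from
the origin has inner product at least `1 / (2 √n)` with `w`. -/
def wedge (T : ℝ) (w : E) : Set (Hyperplane n) :=
  {H | 0 < H.dist 0} ∩ ({H | H.dist 0 ≤ T} ∩ ({H | 1 / 2 ≤ Real.sqrt n * H.absInner w} ∩
    {H | H.dist w ≤ H.dist (-w)}))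

omit [NeZero n] in
theorem measurableSet_wedge (T : ℝ) (w : E) : MeasurableSet (wedge T w) :=
  (measurableSet_lt measurable_const (measurable_hyperplane_dist 0)).inter
    ((measurableSet_dist_zero_le T).inter
      ((measurableSet_le measurable_const ((measurable_absInner w).const_mul _)).inter
        (measurableSet_le (measurable_hyperplane_dist w) (measurable_hyperplane_dist (-w)))))

-- The sign of `⟨u,w⟩`, lost in `absInner`, is recovered by comparing distances: for `τ > 0`, `|a -
-- τ| ≤ |a + τ|` exactly when `a ≥ 0`.
omit [NeZero n] in
theorem hyperplaneOf_mem_wedge {T : ℝ} {w : E} {p : Metric.sphere (0 : E) 1 × ℝ} (hp : 0 < p.2) :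
    hyperplaneOf n p ∈ wedge T w ↔ p.2 ≤ T ∧ 1 / 2 ≤ Real.sqrt n * inner ℝ (p.1 : E) w := by
  have h1 : hyperplaneOf n p ∈ wedge T w ↔ 0 < p.2 ∧ p.2 ≤ T ∧
      1 / 2 ≤ Real.sqrt n * |inner ℝ (p.1 : E) w| ∧
      |inner ℝ (p.1 : E) w - p.2| ≤ |-inner ℝ (p.1 : E) w - p.2| := by
    simp only [wedge, Set.mem_inter_iff, Set.mem_ofPred_eq, dist_zero_hyperplaneOf hp.le,
      absInner_hyperplaneOf hp.le, dist_hyperplaneOf, inner_neg_left,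
      real_inner_comm (p.1 : E) w]
  have h2 : |inner ℝ (p.1 : E) w - p.2| ≤ |-inner ℝ (p.1 : E) w - p.2| ↔
      0 ≤ inner ℝ (p.1 : E) w := by
    rw [← sq_le_sq]
    constructor
    · intro h; nlinarith
    · intro h; nlinarith [mul_nonneg h hp.le]
  rw [h1, h2]
  constructor
  · rintro ⟨-, h3, h4, h5⟩
    rw [abs_of_nonneg h5] at h4
    exact ⟨h3, h4⟩
  · rintro ⟨h3, h4⟩
    have h5 : 0 ≤ inner ℝ (p.1 : E) w := by
      by_contra hneg
      push Not at hneg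
      have := mul_nonpos_of_nonneg_of_nonpos (Real.sqrt_nonneg n) hneg.le
      linarith
    exact ⟨hp, h3, by rwa [abs_of_nonneg h5], h5⟩

theorem le_hyperplaneIntensity_wedge {γ T : ℝ} (hγ : 0 ≤ γ) (hT : 0 ≤ T) {w : E} (hw : ‖w‖ = 1) :
    ENNReal.ofReal (2 * γ * T * capConst) ≤ hyperplaneIntensity n γ (wedge T w) := by
  rw [← lintegral_indicator_one (measurableSet_wedge T w),
    lintegral_hyperplaneIntensity γ (measurable_one.indicator (measurableSet_wedge T w))]
  have hS : MeasurableSet {u : Metric.sphere (0 : E) 1 |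
      1 / 2 ≤ Real.sqrt n * inner ℝ (u : E) w} :=
    measurableSet_le measurable_const ((measurable_inner_sphere w).const_mul _)
  have hlow : ∀ u : Metric.sphere (0 : E) 1,
      {u : Metric.sphere (0 : E) 1 | 1 / 2 ≤ Real.sqrt n * inner ℝ (u : E) w}.indicator
        (fun _ => ENNReal.ofReal T) u ≤
      ∫⁻ τ in Set.Ici (0 : ℝ), (wedge T w).indicator 1 (hyperplaneOf n (u, τ)) := by
    intro u
    by_cases hu : u ∈ {u : Metric.sphere (0 : E) 1 | 1 / 2 ≤ Real.sqrt n * inner ℝ (u : E) w}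
    · rw [Set.indicator_of_mem hu]
      calc ENNReal.ofReal T = ∫⁻ τ in Set.Ioc 0 T, 1 := by simp
        _ ≤ ∫⁻ τ in Set.Ioc 0 T, (wedge T w).indicator 1 (hyperplaneOf n (u, τ)) := by
          refine lintegral_mono_ae ?_
          filter_upwards [ae_restrict_mem measurableSet_Ioc] with τ hτ
          rw [Set.indicator_of_mem ((hyperplaneOf_mem_wedge (p := (u, τ)) hτ.1).2 ⟨hτ.2, hu⟩)]
          rfl
        _ ≤ _ := lintegral_mono_set fun τ hτ => hτ.1.le
    · rw [Set.indicator_of_notMem hu]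
      exact zero_le
  calc _ = ENNReal.ofReal (2 * γ) * (ENNReal.ofReal T * ENNReal.ofReal capConst) := by
        rw [mul_assoc (2 * γ), ENNReal.ofReal_mul (by positivity), ENNReal.ofReal_mul hT]
    _ ≤ ENNReal.ofReal (2 * γ) * (ENNReal.ofReal T * uniformSphere n
        {u | 1 / 2 ≤ Real.sqrt n * inner ℝ (u : E) w}) := by
        gcongr
        have := capConst_le_usphere hw
        rw [finrank_euclideanSpace_fin] at this
        exact this
    _ ≤ _ := by
        gcongr
        rw [← lintegral_indicator_const hS]
        exact lintegral_mono hlow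

/-- The weight `(1 + √n |⟨u, w⟩|) / 8` of the hyperplanes at distance at most `T`. -/
noncomputable def slabWeight (T : ℝ) (w : E) (H : Hyperplane n) : ℝ :=
  {H : Hyperplane n | H.dist 0 ≤ T}.indicator (fun H => (1 + Real.sqrt n * H.absInner w) / 8) H

omit [NeZero n] in
theorem measurable_slabWeight (T : ℝ) (w : E) : Measurable (slabWeight T w) :=
  (((measurable_const.add ((measurable_absInner w).const_mul _)).div_const _).indicator
    (measurableSet_dist_zero_le T))

theorem lintegral_uniformSphere_exp_sq_le {w : E} (hw : ‖w‖ = 1) :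
    ∫⁻ u, ENNReal.ofReal (Real.exp (n * inner ℝ (u : E) w ^ 2 / 8)) ∂uniformSphere n ≤
      ENNReal.ofReal sphereExpConst := by
  have := lintegral_usphere_exp_sq_le hw
  rw [finrank_euclideanSpace_fin] at this
  exact this

/-- With `y = √n|⟨u,w⟩|` one has `(1 + y)/8 ≤ 1/4 + y²/8`, which reduces to the moment of squared
coordinates. The summand `1` in the weight lets one tail event control the number of hyperplanes as
well. -/
theorem lintegral_exp_slabWeight_le {γ T : ℝ} (hγ : 0 ≤ γ) {w : E} (hw : ‖w‖ = 1) :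
    ∫⁻ H, ENNReal.ofReal (Real.exp (slabWeight T w H) - 1) ∂hyperplaneIntensity n γ ≤
      ENNReal.ofReal (2 * γ * T * (Real.exp (1 / 4) * sphereExpConst)) := by
  have hC := one_le_sphereExpConst
  refine (lintegral_hyperplaneIntensity_le γ
    (((Real.measurable_exp.comp (measurable_slabWeight T w)).sub_const 1).ennreal_ofReal)
    (a := (Set.Iic T).indicator 1)
    (b := fun u => ENNReal.ofReal (Real.exp (1 / 4)) *
      ENNReal.ofReal (Real.exp (n * inner ℝ (u : E) w ^ 2 / 8)))
    (measurable_one.indicator measurableSet_Iic) (by fun_prop) fun u τ hτ => ?_).trans ?_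
  · by_cases hT : τ ≤ T
    · have hmem : hyperplaneOf n (u, τ) ∈ {H : Hyperplane n | H.dist 0 ≤ T} := by
        change (hyperplaneOf n (u, τ)).dist 0 ≤ T
        rwa [dist_zero_hyperplaneOf (p := (u, τ)) hτ]
      change ENNReal.ofReal (Real.exp (slabWeight T w (hyperplaneOf n (u, τ))) - 1) ≤ _
      rw [Set.indicator_of_mem (s := Set.Iic T) hT, slabWeight, Set.indicator_of_mem hmem,
        absInner_hyperplaneOf (p := (u, τ)) hτ, Pi.one_apply, mul_one,
        ← ENNReal.ofReal_mul (Real.exp_pos _).le, ← Real.exp_add]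
      apply ENNReal.ofReal_le_ofReal
      refine (sub_le_self _ zero_le_one).trans (Real.exp_le_exp.2 ?_)
      have h1 : (Real.sqrt n * |inner ℝ (u : E) w|) ^ 2 = n * inner ℝ (u : E) w ^ 2 := by
        rw [mul_pow, Real.sq_sqrt (Nat.cast_nonneg n), sq_abs]
      nlinarith [sq_nonneg (Real.sqrt n * |inner ℝ (u : E) w| - 1)]
    · have hmem : hyperplaneOf n (u, τ) ∉ {H : Hyperplane n | H.dist 0 ≤ T} := by
        change ¬ (hyperplaneOf n (u, τ)).dist 0 ≤ T
        rwa [dist_zero_hyperplaneOf (p := (u, τ)) hτ]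
      change ENNReal.ofReal (Real.exp (slabWeight T w (hyperplaneOf n (u, τ))) - 1) ≤ _
      rw [slabWeight, Set.indicator_of_notMem hmem]
      simp
  · rw [lintegral_const_mul _ (by fun_prop), volume_Ici_inter_Iic]
    by_cases hT : 0 ≤ T
    · calc _ ≤ ENNReal.ofReal (2 * γ) * (ENNReal.ofReal (Real.exp (1 / 4)) *
            ENNReal.ofReal sphereExpConst * ENNReal.ofReal T) := by
            gcongr; exact lintegral_uniformSphere_exp_sq_le hw
        _ = _ := by
            rw [← ENNReal.ofReal_mul (by positivity), ← ENNReal.ofReal_mul (by positivity),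
              ← ENNReal.ofReal_mul (by positivity)]
            congr 1; ring
    · rw [ENNReal.ofReal_of_nonpos (not_le.1 hT).le]
      simp

/-- The decay profile `min 1 (t ^ (-3/2))`. -/
noncomputable def decay (t : ℝ) : ℝ := if t ≤ 1 then 1 else t ^ (-(3 / 2) : ℝ)

omit [NeZero n] in
theorem measurable_decay : Measurable decay :=
  Measurable.ite measurableSet_Iic measurable_const (by fun_prop)

theorem decay_pos (t : ℝ) : 0 < decay t := by
  unfold decay
  split_ifs with h
  · exact one_pos
  · exact Real.rpow_pos_of_pos (by linarith) _

theorem decay_le_one (t : ℝ) : decay t ≤ 1 := by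
  unfold decay
  split_ifs with h
  · exact le_rfl
  · exact Real.rpow_le_one_of_one_le_of_nonpos (by linarith) (by norm_num)

theorem lintegral_decay_le {c : ℝ} (hc : 0 < c) :
    ∫⁻ τ in Set.Ici (0 : ℝ), ENNReal.ofReal (decay (τ / c)) ≤ ENNReal.ofReal (3 * c) := by
  have hle : ∀ τ ∈ Set.Ici (0 : ℝ), ENNReal.ofReal (decay (τ / c)) ≤
      (Set.Iic c).indicator 1 τ + (Set.Ioi c).indicator
        (fun τ => ENNReal.ofReal (c ^ (3 / 2 : ℝ) * τ ^ (-(3 / 2) : ℝ))) τ := by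
    intro τ hτ
    by_cases h : τ ≤ c
    · rw [Set.indicator_of_mem (s := Set.Iic c) h]
      refine le_trans ?_ le_self_add
      simpa using decay_le_one (τ / c)
    · push Not at h
      rw [Set.indicator_of_mem (s := Set.Ioi c) h]
      refine le_trans (ENNReal.ofReal_le_ofReal ?_) le_add_self
      have h1 : ¬ τ / c ≤ 1 := by
        rw [div_le_one hc]; exact not_le.2 h
      rw [decay, if_neg h1, Real.div_rpow hτ hc.le, Real.rpow_neg hc.le (3 / 2), div_inv_eq_mul,
        mul_comm]
  have hint : ∫⁻ τ in Set.Ioi c, ENNReal.ofReal (c ^ (3 / 2 : ℝ) * τ ^ (-(3 / 2) : ℝ)) =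
      ENNReal.ofReal (2 * c) := by
    rw [← ofReal_integral_eq_lintegral_ofReal
      ((integrableOn_Ioi_rpow_of_lt (by norm_num) hc).const_mul _)]
    · rw [integral_const_mul, integral_Ioi_rpow_of_lt (by norm_num) hc]
      congr 1
      have h2 : c ^ (3 / 2 : ℝ) * c ^ (-(3 / 2) + 1 : ℝ) = c := by
        rw [← Real.rpow_add hc]; norm_num
      rw [mul_div_assoc']
      have h3 : c ^ (3 / 2 : ℝ) * -c ^ (-(3 / 2) + 1 : ℝ) = -c := by linarith
      rw [h3]; ring
    · filter_upwards [ae_restrict_mem measurableSet_Ioi] with τ hτ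
      have : (0 : ℝ) < τ := hc.trans hτ
      simp only [Pi.zero_apply]
      positivity
  calc _ ≤ ∫⁻ τ in Set.Ici (0 : ℝ), ((Set.Iic c).indicator 1 τ + (Set.Ioi c).indicator
        (fun τ => ENNReal.ofReal (c ^ (3 / 2 : ℝ) * τ ^ (-(3 / 2) : ℝ))) τ) := by
        refine lintegral_mono_ae ?_
        filter_upwards [ae_restrict_mem measurableSet_Ici] with τ hτ using hle τ hτ
    _ ≤ ENNReal.ofReal c + ∫⁻ τ in Set.Ioi c,
        ENNReal.ofReal (c ^ (3 / 2 : ℝ) * τ ^ (-(3 / 2) : ℝ)) := by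
        rw [lintegral_add_left (measurable_one.indicator measurableSet_Iic), volume_Ici_inter_Iic]
        refine add_le_add_right ?_ _
        rw [← lintegral_indicator measurableSet_Ioi]
        exact lintegral_mono' Measure.restrict_le_self le_rfl
    _ = _ := by
        rw [hint, ← ENNReal.ofReal_add hc.le (by positivity)]
        congr 1; ring

/-- The squared norm of the projection to `L` of a unit normal of a hyperplane. -/
noncomputable def projSq (L : Submodule ℝ E) (H : Hyperplane n) : ℝ :=
  ∑ k, H.absInner (stdOrthonormalBasis ℝ L k : E) ^ 2

omit [NeZero n] in
theorem measurable_projSq (L : Submodule ℝ E) : Measurable (projSq L) :=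
  Finset.measurable_sum _ fun _ _ => (measurable_absInner _).pow_const 2

omit [NeZero n] in
theorem projSq_nonneg (L : Submodule ℝ E) (H : Hyperplane n) : 0 ≤ projSq L H :=
  Finset.sum_nonneg fun _ _ => sq_nonneg _

omit [NeZero n] in
theorem projSq_hyperplaneOf (L : Submodule ℝ E) {p : Metric.sphere (0 : E) 1 × ℝ} (hp : 0 ≤ p.2) :
    projSq L (hyperplaneOf n p) = ∑ k, inner ℝ (p.1 : E) (stdOrthonormalBasis ℝ L k : E) ^ 2 := by
  simp only [projSq, absInner_hyperplaneOf hp, sq_abs]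

/-- The weight `min 1 (t ^ (-3/2)) (1 + n |P_L u|² / dim L) / 8`, with `t` the distance to the
origin in units of `c`, of the hyperplanes at distance at most `T`. -/
noncomputable def farWeight (L : Submodule ℝ E) (c T : ℝ) (H : Hyperplane n) : ℝ :=
  {H : Hyperplane n | H.dist 0 ≤ T}.indicator
    (fun H => decay (H.dist 0 / c) * ((1 + n / Module.finrank ℝ L * projSq L H) / 8)) H

omit [NeZero n] in
theorem measurable_farWeight (L : Submodule ℝ E) (c T : ℝ) : Measurable (farWeight L c T) :=
  (((measurable_decay.comp ((measurable_hyperplane_dist 0).div_const _)).mul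
    ((measurable_const.add ((measurable_projSq L).const_mul _)).div_const _)).indicator
    (measurableSet_dist_zero_le T))

/-- The exponent is an average over the orthonormal basis of `L`; Jensen's inequality reduces it to
single coordinates, with a bound free of `dim L`. -/
theorem lintegral_exp_projSq_le {L : Submodule ℝ E} (hL : 0 < Module.finrank ℝ L) :
    ∫⁻ u, ENNReal.ofReal (Real.exp ((n / Module.finrank ℝ L *
      ∑ k, inner ℝ (u : E) (stdOrthonormalBasis ℝ L k : E) ^ 2) / 8)) ∂uniformSphere n ≤
      ENNReal.ofReal sphereExpConst := by
  set d : ℝ := (Module.finrank ℝ L : ℝ) with hd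
  have hd0 : 0 < d := by rw [hd]; exact_mod_cast hL
  have hpt : ∀ u : Metric.sphere (0 : E) 1, ENNReal.ofReal (Real.exp ((n / d *
      ∑ k, inner ℝ (u : E) (stdOrthonormalBasis ℝ L k : E) ^ 2) / 8)) ≤
      ∑ k, ENNReal.ofReal d⁻¹ * ENNReal.ofReal
        (Real.exp (n * inner ℝ (u : E) (stdOrthonormalBasis ℝ L k : E) ^ 2 / 8)) := by
    intro u
    simp_rw [← ENNReal.ofReal_mul (inv_nonneg.2 hd0.le)]
    rw [← ENNReal.ofReal_sum_of_nonneg fun i _ => by positivity]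
    apply ENNReal.ofReal_le_ofReal
    have := convexOn_exp.map_sum_le (t := Finset.univ) (w := fun _ => d⁻¹)
      (p := fun k => n * inner ℝ (u : E) (stdOrthonormalBasis ℝ L k : E) ^ 2 / 8)
      (fun _ _ => inv_nonneg.2 hd0.le)
      (by rw [Finset.sum_const, Finset.card_univ, Fintype.card_fin, nsmul_eq_mul, ← hd,
            mul_inv_cancel₀ hd0.ne']) (fun _ _ => Set.mem_univ _)
    simp only [smul_eq_mul] at this
    refine le_trans (le_of_eq ?_) this
    congr 1
    rw [Finset.mul_sum, Finset.sum_div]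
    exact Finset.sum_congr rfl fun k _ => by field_simp
  refine (lintegral_mono hpt).trans ?_
  rw [lintegral_finsetSum _ fun k _ => by fun_prop]
  have hk : ∀ k, ∫⁻ u, ENNReal.ofReal d⁻¹ * ENNReal.ofReal
        (Real.exp (n * inner ℝ (u : E) (stdOrthonormalBasis ℝ L k : E) ^ 2 / 8))
        ∂uniformSphere n ≤ ENNReal.ofReal d⁻¹ * ENNReal.ofReal sphereExpConst := by
    intro k
    rw [lintegral_const_mul _ (by fun_prop)]
    gcongr
    exact lintegral_uniformSphere_exp_sq_le ((stdOrthonormalBasis ℝ L).norm_eq_one k)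
  refine (Finset.sum_le_sum fun k _ => hk k).trans (le_of_eq ?_)
  rw [Finset.sum_const, Finset.card_univ, Fintype.card_fin, nsmul_eq_mul, ← mul_assoc,
    ← ENNReal.ofReal_natCast, ← hd, ← ENNReal.ofReal_mul hd0.le, mul_inv_cancel₀ hd0.ne',
    ENNReal.ofReal_one, one_mul]

/-- Convexity gives `exp(λz) - 1 ≤ λ(exp z - 1)` for `0 ≤ λ ≤ 1`. Hence the decay leaves the
exponent and its integral over `τ` converges, so the bound does not depend on `T`. -/
theorem lintegral_exp_farWeight_le {γ c T : ℝ} (hγ : 0 ≤ γ) (hc : 0 < c) {L : Submodule ℝ E}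
    (hL : 0 < Module.finrank ℝ L) :
    ∫⁻ H, ENNReal.ofReal (Real.exp (farWeight L c T H) - 1) ∂hyperplaneIntensity n γ ≤
      ENNReal.ofReal (2 * γ * c * (3 * Real.exp (1 / 8) * sphereExpConst)) := by
  have hC := one_le_sphereExpConst
  set b : Metric.sphere (0 : E) 1 → ℝ := fun u => (n / Module.finrank ℝ L *
      ∑ k, inner ℝ (u : E) (stdOrthonormalBasis ℝ L k : E) ^ 2) / 8 with hb
  have hbm : Measurable b := by
    rw [hb]
    exact ((Finset.measurable_sum _ fun _ _ =>
      ((measurable_inner_sphere _).pow_const 2)).const_mul _).div_const _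
  have hbe : Measurable fun u => Real.exp (b u) := Real.measurable_exp.comp hbm
  refine (lintegral_hyperplaneIntensity_le γ
    (((Real.measurable_exp.comp (measurable_farWeight L c T)).sub_const 1).ennreal_ofReal)
    (a := fun τ => ENNReal.ofReal (decay (τ / c)))
    (b := fun u => ENNReal.ofReal (Real.exp (1 / 8)) * ENNReal.ofReal (Real.exp (b u)))
    (measurable_decay.comp (measurable_id.div_const c)).ennreal_ofReal
    (hbe.ennreal_ofReal.const_mul _) fun u τ hτ => ?_).trans ?_
  · by_cases hT : τ ≤ T
    · have hmem : hyperplaneOf n (u, τ) ∈ {H : Hyperplane n | H.dist 0 ≤ T} := by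
        change (hyperplaneOf n (u, τ)).dist 0 ≤ T
        rwa [dist_zero_hyperplaneOf (p := (u, τ)) hτ]
      change ENNReal.ofReal (Real.exp (farWeight L c T (hyperplaneOf n (u, τ))) - 1) ≤ _
      rw [farWeight, Set.indicator_of_mem hmem, projSq_hyperplaneOf (p := (u, τ)) L hτ,
        dist_zero_hyperplaneOf (p := (u, τ)) hτ, ← ENNReal.ofReal_mul (Real.exp_pos _).le,
        ← Real.exp_add, ← ENNReal.ofReal_mul (Real.exp_pos _).le]
      apply ENNReal.ofReal_le_ofReal
      have h1 := decay_pos (τ / c)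
      have h2 := decay_le_one (τ / c)
      have hconv := convexOn_exp.2 (Set.mem_univ 0) (Set.mem_univ (1 / 8 + b u))
        (sub_nonneg.2 h2) h1.le (by ring)
      simp only [smul_eq_mul, mul_zero, zero_add, Real.exp_zero, mul_one] at hconv
      have h3 : (1 + n / Module.finrank ℝ L *
          ∑ k, inner ℝ (u : E) (stdOrthonormalBasis ℝ L k : E) ^ 2) / 8 = 1 / 8 + b u := by
        rw [hb]; ring
      rw [h3]
      linarith
    · have hmem : hyperplaneOf n (u, τ) ∉ {H : Hyperplane n | H.dist 0 ≤ T} := by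
        change ¬ (hyperplaneOf n (u, τ)).dist 0 ≤ T
        rwa [dist_zero_hyperplaneOf (p := (u, τ)) hτ]
      change ENNReal.ofReal (Real.exp (farWeight L c T (hyperplaneOf n (u, τ))) - 1) ≤ _
      rw [farWeight, Set.indicator_of_notMem hmem]
      simp
  · rw [lintegral_const_mul _ hbe.ennreal_ofReal]
    calc _ ≤ ENNReal.ofReal (2 * γ) * (ENNReal.ofReal (Real.exp (1 / 8)) *
            ENNReal.ofReal sphereExpConst * ENNReal.ofReal (3 * c)) := by
          gcongr
          · exact lintegral_exp_projSq_le hL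
          · exact lintegral_decay_le hc
      _ = _ := by
          rw [← ENNReal.ofReal_mul (by positivity), ← ENNReal.ofReal_mul (by positivity),
            ← ENNReal.ofReal_mul (by positivity)]
          congr 1; ring

end IntensityBounds

/-! ### Nets of unit spheres by volume comparison. -/

section Nets

theorem card_le_of_separated_sphere {V : Type*} [NormedAddCommGroup V] [NormedSpace ℝ V]
    [FiniteDimensional ℝ V] {δ : ℝ} (hδ : 0 < δ) (hδ1 : δ ≤ 1) (s : Finset V)
    (hs : ∀ c ∈ s, ‖c‖ = 1) (h : ∀ c ∈ s, ∀ d ∈ s, c ≠ d → δ ≤ ‖c - d‖) :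
    (s.card : ℝ) ≤ (3 / δ) ^ Module.finrank ℝ V := by
  borelize V
  let μ : Measure V := Measure.addHaar
  set A := ⋃ c ∈ s, Metric.ball (c : V) (δ / 2) with hA
  have D : Set.Pairwise (s : Set V) (Function.onFun Disjoint fun c => Metric.ball (c : V) (δ / 2)) := by
    rintro c hc d hd hcd
    apply Metric.ball_disjoint_ball
    rw [dist_eq_norm, add_halves]
    exact h c hc d hd hcd
  have A_subset : A ⊆ Metric.ball (0 : V) (3 / 2) := by
    refine Set.iUnion₂_subset fun x hx => Metric.ball_subset_ball' ?_
    rw [dist_zero_right, hs x hx]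
    linarith
  have I : (s.card : ℝ≥0∞) * ENNReal.ofReal ((δ / 2) ^ Module.finrank ℝ V) *
      μ (Metric.ball 0 1) ≤
      ENNReal.ofReal ((3 / 2) ^ Module.finrank ℝ V) * μ (Metric.ball 0 1) :=
    calc _ = μ A := by
          rw [hA, measure_biUnion_finset D fun c _ => measurableSet_ball]
          simp only [μ.addHaar_ball_of_pos _ (half_pos hδ)]
          simp only [Finset.sum_const, nsmul_eq_mul, mul_assoc]
      _ ≤ μ (Metric.ball (0 : V) (3 / 2)) := measure_mono A_subset
      _ = _ := by
          simp only [μ.addHaar_ball_of_pos (0 : V) (show (0 : ℝ) < 3 / 2 by norm_num)]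
  have J : (s.card : ℝ≥0∞) * ENNReal.ofReal ((δ / 2) ^ Module.finrank ℝ V) ≤
      ENNReal.ofReal ((3 / 2) ^ Module.finrank ℝ V) :=
    (ENNReal.mul_le_mul_iff_left (Metric.measure_ball_pos _ _ zero_lt_one).ne'
      measure_ball_lt_top.ne).1 I
  have K := ENNReal.toReal_le_of_le_ofReal (by positivity) J
  rw [ENNReal.toReal_mul, ENNReal.toReal_natCast, ENNReal.toReal_ofReal (by positivity),
    ← le_div_iff₀ (by positivity), ← div_pow] at K
  refine K.trans (le_of_eq ?_)
  congr 1
  field_simp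

/-- A `δ`-separated set of maximal cardinality is a net. -/
theorem exists_sphere_net (V : Type*) [NormedAddCommGroup V] [NormedSpace ℝ V]
    [FiniteDimensional ℝ V] {δ : ℝ} (hδ : 0 < δ) (hδ1 : δ ≤ 1) :
    ∃ N : Finset V, (∀ w ∈ N, ‖w‖ = 1) ∧ (∀ v : V, ‖v‖ = 1 → ∃ w ∈ N, ‖v - w‖ ≤ δ) ∧
      (N.card : ℝ) ≤ (3 / δ) ^ Module.finrank ℝ V := by
  classical
  set S : Set ℕ := {k | ∃ s : Finset V, (∀ c ∈ s, ‖c‖ = 1) ∧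
    (∀ c ∈ s, ∀ d ∈ s, c ≠ d → δ ≤ ‖c - d‖) ∧ s.card = k} with hS
  have hne : S.Nonempty := ⟨0, ∅, by simp⟩
  have hbdd : BddAbove S := by
    refine ⟨⌊(3 / δ) ^ Module.finrank ℝ V⌋₊, ?_⟩
    rintro k ⟨s, h1, h2, rfl⟩
    exact Nat.le_floor (card_le_of_separated_sphere hδ hδ1 s h1 h2)
  obtain ⟨N, h1, h2, h3⟩ := Nat.sSup_mem hne hbdd
  refine ⟨N, h1, fun v hv => ?_, card_le_of_separated_sphere hδ hδ1 N h1 h2⟩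
  by_contra hcon
  push Not at hcon
  have hvN : v ∉ N := fun hmem => by
    have := hcon v hmem
    rw [sub_self, norm_zero] at this
    linarith
  have hmem : N.card + 1 ∈ S := by
    refine ⟨insert v N, ?_, ?_, Finset.card_insert_of_notMem hvN⟩
    · intro c hc
      rcases Finset.mem_insert.1 hc with rfl | hc
      · exact hv
      · exact h1 c hc
    · intro c hc d hd hcd
      rcases Finset.mem_insert.1 hc with rfl | hc' <;>
        rcases Finset.mem_insert.1 hd with rfl | hd'
      · exact absurd rfl hcd
      · exact (hcon d hd').le
      · rw [norm_sub_rev]; exact (hcon c hc').le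
      · exact h2 c hc' d hd' hcd
  have := le_csSup hbdd hmem
  omega

end Nets

/-! ### Reduction from a random to a deterministic subspace. -/

section RandomSubspace

variable {n : ℕ}

/-- Every unit vector of `L` is at distance at most `η` from a unit vector of `K`. -/
def SubspaceNear (η : ℝ) (L K : Submodule ℝ (EuclideanSpace ℝ (Fin n))) : Prop :=
  ∀ v ∈ L, ‖v‖ = 1 → ∃ w ∈ K, ‖w‖ = 1 ∧ ‖v - w‖ ≤ η

/-- Record which of finitely many small caps the subspace meets. This pattern takes finitely many
values, and two subspaces with the same pattern are near. On each attained pattern a fixed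
representative replaces `L ω`, and independence factors the probability. The event `T` need not be
measurable. -/
theorem measure_le_of_forall_subspaceNear {Ω α : Type*} [MeasurableSpace Ω] [MeasurableSpace α]
    {P : Measure Ω} [IsProbabilityMeasure P] {X : Ω → α}
    {L : Ω → Submodule ℝ (EuclideanSpace ℝ (Fin n))} (hL : Measurable L)
    (hind : IndepFun X L P) {η : ℝ} (hη : 0 < η)
    (B : Submodule ℝ (EuclideanSpace ℝ (Fin n)) → Set α) (hB : ∀ K, MeasurableSet (B K))
    {m : ℕ} (hm : ∀ ω, Module.finrank ℝ (L ω) = m) {p : ℝ≥0∞}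
    (hp : ∀ K : Submodule ℝ (EuclideanSpace ℝ (Fin n)), Module.finrank ℝ K = m → P (X ⁻¹' B K) ≤ p) {T : Set Ω}
    (hT : ∀ ω ∈ T, ∀ K : Submodule ℝ (EuclideanSpace ℝ (Fin n)), Module.finrank ℝ K = m → SubspaceNear η (L ω) K → X ω ∈ B K) :
    P T ≤ p := by
  obtain ⟨t, -, htfin, hcov⟩ := (isCompact_sphere (0 : EuclideanSpace ℝ (Fin n)) 1).finite_cover_balls
    (half_pos hη)
  have := htfin.fintype
  set C : t → Set (EuclideanSpace ℝ (Fin n)) := fun x =>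
    Metric.sphere 0 1 ∩ Metric.closedBall (x : EuclideanSpace ℝ (Fin n)) (η / 2) with hC
  have hCc : ∀ x, IsCompact (C x) := fun x =>
    (isCompact_sphere _ _).inter_right Metric.isClosed_closedBall
  set J : Submodule ℝ (EuclideanSpace ℝ (Fin n)) → t → Prop := fun K x =>
    ((K : Set (EuclideanSpace ℝ (Fin n))) ∩ C x).Nonempty with hJ
  have hJm : Measurable J := measurable_pi_lambda _ fun x =>
    measurableSet_setOfPred.1 (MeasurableSpace.measurableSet_generateFrom ⟨C x, hCc x, rfl⟩)
  have hJL : Measurable fun ω => J (L ω) := hJm.comp hL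
  have hnear : ∀ K K', J K = J K' → SubspaceNear η K K' := by
    intro K K' hKK v hv hv1
    obtain ⟨x, hx, hvx⟩ := Set.mem_iUnion₂.1 (hcov (mem_sphere_zero_iff_norm.2 hv1))
    have h1 : J K ⟨x, hx⟩ := ⟨v, hv, mem_sphere_zero_iff_norm.2 hv1, Metric.ball_subset_closedBall hvx⟩
    rw [hKK] at h1
    obtain ⟨w, hw, hw1, hwx⟩ := h1
    refine ⟨w, hw, mem_sphere_zero_iff_norm.1 hw1, ?_⟩
    rw [← dist_eq_norm]
    have h2 := dist_triangle_right v w x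
    have h3 : dist w x ≤ η / 2 := hwx
    have h4 : dist v x < η / 2 := hvx
    linarith
  have hterm : ∀ j : t → Prop, P (T ∩ {ω | J (L ω) = j}) ≤ p * P {ω | J (L ω) = j} := by
    intro j
    by_cases hj : ∃ ω₀, J (L ω₀) = j
    · obtain ⟨ω₀, hω₀⟩ := hj
      have hsub : T ∩ {ω | J (L ω) = j} ⊆ X ⁻¹' B (L ω₀) ∩ L ⁻¹' (J ⁻¹' {j}) := by
        rintro ω ⟨hω, hωj⟩
        have hωj' : J (L ω) = j := hωj
        exact ⟨hT ω hω (L ω₀) (hm ω₀) (hnear _ _ (hωj'.trans hω₀.symm)), hωj⟩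
      refine (measure_mono hsub).trans ?_
      rw [hind.measure_inter_preimage_eq_mul _ _ (hB _) (hJm (measurableSet_singleton j))]
      gcongr
      · exact hp _ (hm ω₀)
      · exact le_rfl
    · have : T ∩ {ω | J (L ω) = j} = ∅ := by
        ext ω
        simp only [Set.mem_inter_iff, Set.mem_ofPred_eq, Set.mem_empty_iff_false, iff_false, not_and]
        exact fun _ h => hj ⟨ω, h⟩
      rw [this, measure_empty]
      exact zero_le
  classical
  calc P T ≤ P (⋃ j : t → Prop, T ∩ {ω | J (L ω) = j}) :=
        measure_mono fun ω hω => Set.mem_iUnion.2 ⟨J (L ω), hω, rfl⟩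
    _ ≤ ∑' j : t → Prop, P (T ∩ {ω | J (L ω) = j}) := measure_iUnion_le _
    _ ≤ ∑' j : t → Prop, p * P {ω | J (L ω) = j} := ENNReal.tsum_le_tsum hterm
    _ = p * P (⋃ j : t → Prop, {ω | J (L ω) = j}) := by
        rw [ENNReal.tsum_mul_left, measure_iUnion]
        · intro i j hij
          rw [Function.onFun, Set.disjoint_left]
          intro ω h1 h2
          exact hij (Eq.trans (Eq.symm h1) h2)
        · exact fun j => hJL (measurableSet_singleton j)
    _ ≤ p * 1 := by gcongr; exact prob_le_one
    _ = p := mul_one p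

end RandomSubspace

/-! ### The cell has no far point in the subspace. -/

section UpperBound

variable {n : ℕ}

local notation "E" => EuclideanSpace ℝ (Fin n)

theorem absInner_nonneg (H : Hyperplane n) (x : E) : 0 ≤ H.absInner x := by
  obtain ⟨p, hp, rfl⟩ := H.exists_rep
  rw [absInner_hyperplaneOf hp]
  exact abs_nonneg _

theorem absInner_add_le (H : Hyperplane n) (x y : E) :
    H.absInner (x + y) ≤ H.absInner x + H.absInner y := by
  obtain ⟨p, hp, rfl⟩ := H.exists_rep
  simp only [absInner_hyperplaneOf hp, inner_add_right]
  exact abs_add_le _ _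

theorem absInner_smul (H : Hyperplane n) (c : ℝ) (x : E) :
    H.absInner (c • x) = |c| * H.absInner x := by
  obtain ⟨p, hp, rfl⟩ := H.exists_rep
  simp only [absInner_hyperplaneOf hp, real_inner_smul_right, abs_mul]

theorem absInner_le_norm (H : Hyperplane n) (x : E) : H.absInner x ≤ ‖x‖ := by
  obtain ⟨p, hp, rfl⟩ := H.exists_rep
  rw [absInner_hyperplaneOf hp]
  simpa [norm_coe_sphere] using abs_real_inner_le_norm (p.1 : E) x

/-- The comparison is required only at the atoms: it will be used where the inequality holds because
the hyperplane is charged. -/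
theorem lintegral_sum_dirac_mono {S ι : Type*} [MeasurableSpace S] {h : ι → S}
    {f g : S → ℝ≥0∞} (hf : Measurable f) (hg : Measurable g) (hfg : ∀ i, f (h i) ≤ g (h i)) :
    ∫⁻ x, f x ∂(Measure.sum fun i => Measure.dirac (h i)) ≤
      ∫⁻ x, g x ∂(Measure.sum fun i => Measure.dirac (h i)) := by
  rw [lintegral_sum_measure, lintegral_sum_measure]
  refine ENNReal.tsum_le_tsum fun i => ?_
  rw [lintegral_dirac' _ hf, lintegral_dirac' _ hg]
  exact hfg i

theorem sum_dirac_singleton_ne_zero {S ι : Type*} [MeasurableSpace S] (h : ι → S) (i : ι) :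
    (Measure.sum fun i => Measure.dirac (h i)) {h i} ≠ 0 := by
  have h1 : (1 : ℝ≥0∞) ≤ (Measure.sum fun i => Measure.dirac (h i)) {h i} := by
    rw [← Measure.dirac_apply_of_mem (Set.mem_singleton (h i))]
    exact Measure.le_sum (fun i => Measure.dirac (h i)) i _
  exact (lt_of_lt_of_le one_pos h1).ne'

/-- The sum of `√n |⟨u, x⟩|` over the hyperplanes of a process at distance at most `T`. -/
noncomputable def slabSum (T : ℝ) (μ : Measure (Hyperplane n)) (x : E) : ℝ≥0∞ :=
  ∫⁻ H in {H : Hyperplane n | H.dist 0 ≤ T}, ENNReal.ofReal (Real.sqrt n * H.absInner x) ∂μ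

theorem measurable_sqrt_absInner (x : E) :
    Measurable fun H : Hyperplane n => ENNReal.ofReal (Real.sqrt n * H.absInner x) :=
  ((measurable_absInner x).const_mul _).ennreal_ofReal

theorem slabSum_add_le (T : ℝ) (μ : Measure (Hyperplane n)) (x y : E) :
    slabSum T μ (x + y) ≤ slabSum T μ x + slabSum T μ y := by
  rw [slabSum, slabSum, slabSum, ← lintegral_add_left (measurable_sqrt_absInner x)]
  refine lintegral_mono fun H => ?_
  rw [← ENNReal.ofReal_add (mul_nonneg (Real.sqrt_nonneg _) (absInner_nonneg H x))
    (mul_nonneg (Real.sqrt_nonneg _) (absInner_nonneg H y)), ← mul_add]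
  exact ENNReal.ofReal_le_ofReal (mul_le_mul_of_nonneg_left (absInner_add_le H x y)
    (Real.sqrt_nonneg _))

theorem slabSum_smul (T : ℝ) (μ : Measure (Hyperplane n)) (c : ℝ) (x : E) :
    slabSum T μ (c • x) = ENNReal.ofReal |c| * slabSum T μ x := by
  rw [slabSum, slabSum, ← lintegral_const_mul _ (measurable_sqrt_absInner x)]
  refine lintegral_congr fun H => ?_
  rw [absInner_smul, ← ENNReal.ofReal_mul (abs_nonneg c)]
  congr 1; ring

theorem slabSum_le_norm (T : ℝ) (μ : Measure (Hyperplane n)) (x : E) :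
    slabSum T μ x ≤ ENNReal.ofReal (Real.sqrt n * ‖x‖) * μ {H | H.dist 0 ≤ T} := by
  rw [slabSum, ← setLIntegral_const]
  exact lintegral_mono fun H => ENNReal.ofReal_le_ofReal
    (mul_le_mul_of_nonneg_left (absInner_le_norm H x) (Real.sqrt_nonneg _))

theorem lintegral_slabWeight (T : ℝ) (μ : Measure (Hyperplane n)) (w : E) :
    ∫⁻ H, ENNReal.ofReal (slabWeight T w H) ∂μ =
      ENNReal.ofReal (1 / 8) * (μ {H | H.dist 0 ≤ T} + slabSum T μ w) := by
  have h1 : ∀ H : Hyperplane n, ENNReal.ofReal (slabWeight T w H) =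
      {H : Hyperplane n | H.dist 0 ≤ T}.indicator (fun H => ENNReal.ofReal (1 / 8) *
        (1 + ENNReal.ofReal (Real.sqrt n * H.absInner w))) H := by
    intro H
    by_cases hH : H ∈ {H : Hyperplane n | H.dist 0 ≤ T}
    · have h2 := mul_nonneg (Real.sqrt_nonneg n) (absInner_nonneg H w)
      rw [slabWeight, Set.indicator_of_mem hH, Set.indicator_of_mem hH, ← ENNReal.ofReal_one,
        ← ENNReal.ofReal_add zero_le_one h2, ← ENNReal.ofReal_mul (by norm_num)]
      congr 1; ring
    · rw [slabWeight, Set.indicator_of_notMem hH, Set.indicator_of_notMem hH, ENNReal.ofReal_zero]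
  simp_rw [h1]
  rw [lintegral_indicator (measurableSet_dist_zero_le T),
    lintegral_const_mul _ ((measurable_sqrt_absInner w).const_add 1),
    lintegral_add_left measurable_const, setLIntegral_one]
  rfl

/-- `slabSum` is a seminorm; its supremum `F` over the unit sphere of `K` satisfies `F ≤ A + δF`.
Finiteness of `F`, from the finite count, allows absorbing `δF`. -/
theorem slabSum_le_of_net {T : ℝ} {μ : Measure (Hyperplane n)} {K : Submodule ℝ E} {N : Finset K}
    {δ A : ℝ} (hδ : 0 < δ) (hδ1 : δ ≤ 1 / 2) (hA : 0 ≤ A)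
    (hnet : ∀ v : K, ‖v‖ = 1 → ∃ w ∈ N, ‖v - w‖ ≤ δ)
    (hμ : μ {H | H.dist 0 ≤ T} ≠ ∞) (hN : ∀ w ∈ N, slabSum T μ (w : E) ≤ ENNReal.ofReal A) (x : K) :
    slabSum T μ (x : E) ≤ ENNReal.ofReal (2 * A * ‖x‖) := by
  set F : ℝ≥0∞ := ⨆ v : {v : K // ‖v‖ = 1}, slabSum T μ (v : E) with hF
  have hFtop : F ≠ ∞ := by
    refine ne_top_of_le_ne_top (ENNReal.mul_ne_top (ENNReal.ofReal_ne_top (r := Real.sqrt n)) hμ)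
      (iSup_le fun v => (slabSum_le_norm T μ _).trans (le_of_eq ?_))
    have : ‖((v : K) : E)‖ = 1 := v.2
    rw [this, mul_one]
  have hunit : ∀ x : K, slabSum T μ (x : E) ≤ ENNReal.ofReal ‖x‖ * F := by
    intro x
    by_cases hx : x = 0
    · have h0 := slabSum_smul T μ 0 (0 : E)
      rw [zero_smul, abs_zero, ENNReal.ofReal_zero, zero_mul] at h0
      rw [hx, Submodule.coe_zero, h0]
      exact zero_le
    · have hx0 : ‖x‖ ≠ 0 := norm_ne_zero_iff.2 hx
      have h1 : ‖(‖x‖⁻¹ • x : K)‖ = 1 := by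
        rw [norm_smul, norm_inv, norm_norm, inv_mul_cancel₀ hx0]
      have h2 : (x : E) = ‖x‖ • ((‖x‖⁻¹ • x : K) : E) := by
        rw [Submodule.coe_smul, smul_smul, mul_inv_cancel₀ hx0, one_smul]
      rw [h2, slabSum_smul, abs_norm]
      gcongr
      exact le_iSup (fun v : {v : K // ‖v‖ = 1} => slabSum T μ ((v : K) : E)) ⟨_, h1⟩
  have hFle : F ≤ ENNReal.ofReal A + ENNReal.ofReal δ * F := by
    refine iSup_le fun v => ?_
    obtain ⟨w, hw, hvw⟩ := hnet v v.2
    have h1 : ((v : K) : E) = (w : E) + ((v - w : K) : E) := by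
      rw [Submodule.coe_sub]; abel
    rw [h1]
    refine (slabSum_add_le _ _ _ _).trans (add_le_add (hN w hw) ((hunit _).trans ?_))
    gcongr
  have hFr : F ≤ ENNReal.ofReal (2 * A) := by
    rw [← ENNReal.ofReal_toReal hFtop, ← ENNReal.ofReal_mul hδ.le,
      ← ENNReal.ofReal_add hA (by positivity), ENNReal.ofReal_le_ofReal_iff (by positivity)] at hFle
    rw [← ENNReal.ofReal_toReal hFtop]
    apply ENNReal.ofReal_le_ofReal
    have := ENNReal.toReal_nonneg (a := F)
    nlinarith
  calc _ ≤ ENNReal.ofReal ‖x‖ * F := hunit x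
    _ ≤ ENNReal.ofReal ‖x‖ * ENNReal.ofReal (2 * A) := by gcongr
    _ = _ := by
      rw [← ENNReal.ofReal_mul (norm_nonneg _)]
      congr 1; ring

/-- Suppose `‖x‖ > s`, let `v = x/‖x‖` and let `w` be a nearby net point. Each hyperplane of the
wedge of `w` contributes at least `1/4` to `slabSum T μ (w - v)`, so this sum exceeds `q/4`, against
the upper bound `24δa`. -/
theorem norm_le_of_mem_zeroCell_of_net [NeZero n] {s T δ q a : ℝ} (hs : 0 < s)
    (hT : T = s / (4 * Real.sqrt n))
    (hδ : 0 < δ) (hδ1 : δ ≤ 1 / 2) (ha : 0 ≤ a) (hqa : 96 * δ * a ≤ q)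
    {L K : Submodule ℝ E} (hLK : SubspaceNear (δ / Real.sqrt n) L K) {N : Finset K}
    (hnet : ∀ v : K, ‖v‖ = 1 → ∃ w ∈ N, ‖v - w‖ ≤ δ)
    {ι : Type} {h : ι → Hyperplane n} {μ : Measure (Hyperplane n)}
    (hμ : μ = Measure.sum fun i => Measure.dirac (h i))
    (hwedge : ∀ w ∈ N, ENNReal.ofReal q < μ (wedge T (w : E)))
    (hslab : ∀ w ∈ N, ∫⁻ H, ENNReal.ofReal (slabWeight T (w : E) H) ∂μ ≤ ENNReal.ofReal a)
    {x : E} (hx : x ∈ zeroCell μ) (hxL : x ∈ L) : ‖x‖ ≤ s := by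
  by_contra hsx
  push Not at hsx
  have hx0 : 0 < ‖x‖ := hs.trans hsx
  have hn0 : 0 < Real.sqrt n := Real.sqrt_pos.2 (by exact_mod_cast Nat.pos_of_ne_zero (NeZero.ne n))
  set v : E := ‖x‖⁻¹ • x with hv
  have hv1 : ‖v‖ = 1 := by rw [hv, norm_smul, norm_inv, norm_norm, inv_mul_cancel₀ hx0.ne']
  obtain ⟨v', hv'K, hv'1, hvv'⟩ := hLK v (L.smul_mem _ hxL) hv1
  obtain ⟨w, hw, hvw⟩ := hnet ⟨v', hv'K⟩ hv'1
  have hbound : ∀ w ∈ N, μ {H | H.dist 0 ≤ T} + slabSum T μ (w : E) ≤ ENNReal.ofReal (8 * a) := by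
    intro w hw
    have := hslab w hw
    rw [lintegral_slabWeight] at this
    calc _ = ENNReal.ofReal 8 * (ENNReal.ofReal (1 / 8) *
          (μ {H | H.dist 0 ≤ T} + slabSum T μ (w : E))) := by
          rw [← mul_assoc, ← ENNReal.ofReal_mul (by norm_num)]
          norm_num
      _ ≤ ENNReal.ofReal 8 * ENNReal.ofReal a := by gcongr
      _ = _ := by rw [← ENNReal.ofReal_mul (by norm_num)]
  have hμT : μ {H | H.dist 0 ≤ T} ≤ ENNReal.ofReal (8 * a) := le_self_add.trans (hbound w hw)
  have hsup := slabSum_le_of_net (T := T) (μ := μ) (A := 8 * a) hδ hδ1 (by positivity) hnet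
    (ne_top_of_le_ne_top ENNReal.ofReal_ne_top hμT) fun w hw => le_add_self.trans (hbound w hw)
  have hup : slabSum T μ ((w : E) - v) ≤ ENNReal.ofReal (24 * δ * a) := by
    -- The part `v - v'` leaves `K` but has length at most `δ/√n`, so the trivial bound gives `8δa`;
    -- the part in `K` gives `16δa`.
    have h1 : (w : E) - v = ((-1 : ℝ) • (v - v')) + ((w - ⟨v', hv'K⟩ : K) : E) := by
      rw [Submodule.coe_sub]; module
    rw [h1]
    refine (slabSum_add_le _ _ _ _).trans ?_
    rw [slabSum_smul, abs_neg, abs_one, ENNReal.ofReal_one, one_mul]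
    calc _ ≤ ENNReal.ofReal (Real.sqrt n * (δ / Real.sqrt n)) * ENNReal.ofReal (8 * a) +
          ENNReal.ofReal (2 * (8 * a) * δ) := by
          refine add_le_add ((slabSum_le_norm _ _ _).trans (by gcongr)) ((hsup _).trans ?_)
          rw [norm_sub_rev]
          gcongr
      _ = _ := by
          rw [← ENNReal.ofReal_mul (by positivity), ← ENNReal.ofReal_add (by positivity)
            (by positivity), mul_div_cancel₀ _ hn0.ne']
          congr 1; ring
  have hlow : ENNReal.ofReal (1 / 4) * μ (wedge T (w : E)) ≤ slabSum T μ ((w : E) - v) := by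
    rw [slabSum, ← lintegral_indicator (measurableSet_dist_zero_le T),
      ← lintegral_indicator_const (measurableSet_wedge T _), hμ]
    refine lintegral_sum_dirac_mono (measurable_const.indicator (measurableSet_wedge T _))
      ((measurable_sqrt_absInner _).indicator (measurableSet_dist_zero_le T)) fun i => ?_
    by_cases hi : h i ∈ wedge T (w : E)
    · rw [Set.indicator_of_mem hi, Set.indicator_of_mem hi.2.1]
      apply ENNReal.ofReal_le_ofReal
      have hch : μ {h i} ≠ 0 := by rw [hμ]; exact sum_dirac_singleton_ne_zero h i
      obtain ⟨p, hp, hpi⟩ := (h i).exists_rep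
      rw [← hpi] at hi hch ⊢
      have hp0 : 0 < p.2 := by
        have := hi.1
        change 0 < (hyperplaneOf n p).dist 0 at this
        rwa [dist_zero_hyperplaneOf hp] at this
      obtain ⟨h1, h2⟩ := (hyperplaneOf_mem_wedge hp0).1 hi
      have h3 := inner_le_of_mem_zeroCell hp0 hch hx
      have hxv : x = ‖x‖ • v := by rw [hv, smul_smul, mul_inv_cancel₀ hx0.ne', one_smul]
      rw [hxv, real_inner_smul_right] at h3
      -- Here `T = s/(4√n)` is used: `‖x‖⟨u,v⟩ ≤ τ ≤ T` with `‖x‖ > s` leaves half of the `1/2`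
      -- guaranteed for `w`.
      have h4 : Real.sqrt n * inner ℝ (p.1 : E) v ≤ 1 / 4 := by
        by_contra hcon
        push Not at hcon
        have hpos : 0 < inner ℝ (p.1 : E) v := by
          by_contra hneg
          push Not at hneg
          have := mul_nonpos_of_nonneg_of_nonpos hn0.le hneg
          linarith
        have h5 : s * inner ℝ (p.1 : E) v ≤ s / (4 * Real.sqrt n) := by
          rw [← hT]
          exact ((mul_le_mul_of_nonneg_right hsx.le hpos.le).trans h3).trans h1
        rw [le_div_iff₀ (by positivity)] at h5
        nlinarith
      rw [absInner_hyperplaneOf hp, inner_sub_right]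
      have h6 := le_abs_self (inner ℝ (p.1 : E) (w : E) - inner ℝ (p.1 : E) v)
      nlinarith
    · rw [Set.indicator_of_notMem hi]
      exact zero_le
  have hfinal : ENNReal.ofReal (1 / 4) * ENNReal.ofReal q < ENNReal.ofReal (24 * δ * a) :=
    lt_of_lt_of_le (ENNReal.mul_lt_mul_right (by norm_num) ENNReal.ofReal_ne_top (hwedge w hw))
      (hlow.trans hup)
  rw [← ENNReal.ofReal_mul (by norm_num), ENNReal.ofReal_lt_ofReal_iff'] at hfinal
  linarith [hfinal.1]

theorem exists_measure_norm_gt_le : ∃ c D : ℝ, 0 < c ∧ 1 ≤ D ∧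
    ∀ (n : ℕ) [NeZero n] (γ s : ℝ) (m : ℕ) (Ω : Type*) [MeasurableSpace Ω] (P : Measure Ω)
      [IsProbabilityMeasure P] (X : Ω → Measure (Hyperplane n))
      (L : Ω → Submodule ℝ (EuclideanSpace ℝ (Fin n))), 0 ≤ γ → 0 < s →
      IsPoissonProcess P X (hyperplaneIntensity n γ) → Measurable L →
      (∀ ω, Module.finrank ℝ (L ω) = m) → IndepFun X L P →
      P {ω | ∃ x ∈ zeroCell (X ω) ∩ (L ω : Set (EuclideanSpace ℝ (Fin n))), s < ‖x‖} ≤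
        ENNReal.ofReal (2 * D ^ m * Real.exp (-c * (γ * s / (2 * Real.sqrt n)))) := by
  have hC := one_le_sphereExpConst
  have hcap := capConst_pos
  have hcap1 : capConst ≤ 1 := by
    unfold capConst
    rw [div_le_one (by positivity)]
    linarith
  set C₁ : ℝ := Real.exp (1 / 4) * sphereExpConst with hC₁
  have hC₁0 : 0 < C₁ := by positivity
  -- Chosen so that `96δa = q` for the `a` and `q` below, where `q` is half the lower bound for the
  -- mean count of a wedge and `a` exceeds the exponential integral `lC₁` by `l`.
  set δ : ℝ := capConst / (192 * (C₁ + 1)) with hδdef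
  have hδ : 0 < δ := by positivity
  have hδ1 : δ ≤ 1 / 2 := by
    rw [hδdef, div_le_iff₀ (by positivity)]
    linarith
  refine ⟨capConst / 10, 3 / δ, by positivity, ?_, ?_⟩
  · rw [le_div_iff₀ hδ]; linarith
  intro n _ γ s m Ω _ P _ X L hγ hs hX hL hm hind
  have hn0 : 0 < Real.sqrt n := Real.sqrt_pos.2 (by exact_mod_cast Nat.pos_of_ne_zero (NeZero.ne n))
  set T : ℝ := s / (4 * Real.sqrt n) with hT
  have hT0 : 0 < T := by positivity
  set l : ℝ := 2 * γ * T with hl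
  have hl0 : 0 ≤ l := by positivity
  have hleq : γ * s / (2 * Real.sqrt n) = l := by
    rw [hl, hT]; field_simp; ring
  rw [hleq]
  set q : ℝ := l * capConst / 2 with hq
  set a : ℝ := l * (C₁ + 1) with ha
  have hqa : 96 * δ * a ≤ q := by
    rw [hδdef, ha, hq]
    apply le_of_eq
    field_simp
    ring
  choose N hN1 hN2 hN3 using fun K : Submodule ℝ (EuclideanSpace ℝ (Fin n)) =>
    exists_sphere_net K hδ (by linarith : δ ≤ 1)
  set B : Submodule ℝ (EuclideanSpace ℝ (Fin n)) → Set (Measure (Hyperplane n)) := fun K =>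
    ⋃ w ∈ N K, ({μ | μ (wedge T (w : EuclideanSpace ℝ (Fin n))) ≤ ENNReal.ofReal q} ∪
      {μ | ENNReal.ofReal a < ∫⁻ H, ENNReal.ofReal
        (slabWeight T (w : EuclideanSpace ℝ (Fin n)) H) ∂μ}) with hB
  refine measure_le_of_forall_subspaceNear hL hind (div_pos hδ hn0) B ?_ hm ?_ ?_
  · intro K
    refine Finset.measurableSet_biUnion _ fun w _ => MeasurableSet.union ?_ ?_
    · exact measurableSet_le (Measure.measurable_coe (measurableSet_wedge T _)) measurable_const
    · exact measurableSet_lt measurable_const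
        (Measure.measurable_lintegral (measurable_slabWeight T _).ennreal_ofReal)
  · intro K hK
    have hw : ∀ w ∈ N K, P (X ⁻¹' ({μ | μ (wedge T (w : EuclideanSpace ℝ (Fin n))) ≤
        ENNReal.ofReal q} ∪ {μ | ENNReal.ofReal a < ∫⁻ H, ENNReal.ofReal
        (slabWeight T (w : EuclideanSpace ℝ (Fin n)) H) ∂μ})) ≤
        ENNReal.ofReal (2 * Real.exp (-(capConst / 10) * l)) := by
      intro w hw
      have hw1 : ‖(w : EuclideanSpace ℝ (Fin n))‖ = 1 := hN1 K w hw
      have h1 : P {ω | X ω (wedge T (w : EuclideanSpace ℝ (Fin n))) ≤ ENNReal.ofReal q} ≤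
          ENNReal.ofReal (Real.exp (-q / 5)) := by
        refine hX.lower_tail (measurableSet_wedge T _) (by positivity) ?_ ?_
        · have := le_hyperplaneIntensity_wedge hγ hT0.le hw1
          rwa [show 2 * q = 2 * γ * T * capConst by rw [hq, hl]; ring]
        · exact ne_top_of_le_ne_top (hyperplaneIntensity_dist_ne_top γ T)
            (measure_mono fun H hH => hH.2.1)
      have h2 : P {ω | ENNReal.ofReal a < ∫⁻ H, ENNReal.ofReal
          (slabWeight T (w : EuclideanSpace ℝ (Fin n)) H) ∂(X ω)} ≤
          ENNReal.ofReal (Real.exp (l * C₁ - a)) :=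
        hX.upper_tail (hyperplaneIntensity_dist_ne_top γ T) (measurable_slabWeight T _)
          (fun H hH => Set.indicator_of_notMem hH _) (by positivity) (by positivity)
          (lintegral_exp_slabWeight_le hγ hw1)
      rw [Set.preimage_union]
      refine (measure_union_le _ _).trans ((add_le_add h1 h2).trans ?_)
      rw [← ENNReal.ofReal_add (Real.exp_pos _).le (Real.exp_pos _).le]
      apply ENNReal.ofReal_le_ofReal
      rw [two_mul]
      gcongr
      · rw [hq]; linarith
      · rw [ha]; nlinarith
    have hpre : X ⁻¹' B K = ⋃ w ∈ N K, X ⁻¹' ({μ | μ (wedge T (w : EuclideanSpace ℝ (Fin n))) ≤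
        ENNReal.ofReal q} ∪ {μ | ENNReal.ofReal a < ∫⁻ H, ENNReal.ofReal
        (slabWeight T (w : EuclideanSpace ℝ (Fin n)) H) ∂μ}) := by
      rw [hB, Set.preimage_iUnion₂]
    rw [hpre]
    refine (measure_biUnion_finset_le _ _).trans ((Finset.sum_le_sum hw).trans ?_)
    rw [Finset.sum_const, nsmul_eq_mul, ← ENNReal.ofReal_natCast,
      ← ENNReal.ofReal_mul (Nat.cast_nonneg _)]
    apply ENNReal.ofReal_le_ofReal
    have h3 := hN3 K
    rw [hK] at h3
    calc _ ≤ (3 / δ) ^ m * (2 * Real.exp (-(capConst / 10) * l)) := by gcongr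
      _ = _ := by ring
  · rintro ω ⟨x, ⟨hx, hxL⟩, hsx⟩ K _ hLK
    by_contra hcon
    obtain ⟨ι, _, h, hμ⟩ := hX.counting ω
    have hgood : ∀ w ∈ N K, ENNReal.ofReal q < X ω (wedge T (w : EuclideanSpace ℝ (Fin n))) ∧
        ∫⁻ H, ENNReal.ofReal (slabWeight T (w : EuclideanSpace ℝ (Fin n)) H) ∂(X ω) ≤
          ENNReal.ofReal a := by
      intro w hw
      constructor
      · by_contra hc
        exact hcon (Set.mem_iUnion₂.2 ⟨w, hw, Or.inl (not_lt.1 hc)⟩)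
      · by_contra hc
        exact hcon (Set.mem_iUnion₂.2 ⟨w, hw, Or.inr (not_le.1 hc)⟩)
    exact absurd (norm_le_of_mem_zeroCell_of_net hs hT hδ hδ1 (by positivity) hqa hLK (hN2 K) hμ
      (fun w hw => (hgood w hw).1) (fun w hw => (hgood w hw).2) hx hxL) (not_le.2 hsx)

end UpperBound

/-! ### The entropy method: a long vector inside many slabs. -/

section PartialColoring

theorem sum_Icc_two_pow_natAbs_le (B : ℕ) :
    ∑ b ∈ Finset.Icc (-(B : ℤ)) B, ((1 : ℝ) / 2) ^ b.natAbs = 3 - 2 * (1 / 2) ^ B := by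
  induction B with
  | zero => norm_num
  | succ B ih =>
    have h : Finset.Icc (-((B + 1 : ℕ) : ℤ)) ((B + 1 : ℕ) : ℤ) =
        insert (-((B + 1 : ℕ) : ℤ)) (insert ((B + 1 : ℕ) : ℤ) (Finset.Icc (-(B : ℤ)) B)) := by
      ext x
      simp only [Finset.mem_Icc, Finset.mem_insert]
      push_cast
      omega
    rw [h, Finset.sum_insert, Finset.sum_insert, ih]
    · simp only [Int.natAbs_neg, Int.natAbs_natCast, pow_succ]
      ring
    · simp only [Finset.mem_Icc, not_and, not_le]
      push_cast
      omega
    · simp only [Finset.mem_insert, Finset.mem_Icc, not_or, not_and, not_le]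
      push_cast
      omega

/-- The cost of the integer `b` in a code in which `0` has cost `2 δ`. -/
noncomputable def codeCost (δ : ℝ) (b : ℤ) : ℝ :=
  if b = 0 then 2 * δ else Real.log (2 / δ) + b.natAbs * Real.log 2

/-- Kraft's inequality: the pattern `0` has weight at most `1 - δ` and the nonzero integers share at
most `δ`. -/
theorem sum_exp_neg_codeCost_le {δ : ℝ} (hδ : 0 < δ) (hδ1 : δ ≤ 1 / 2) (B : ℕ) :
    ∑ b ∈ Finset.Icc (-(B : ℤ)) B, Real.exp (-codeCost δ b) ≤ 1 := by
  have h0 : (0 : ℤ) ∈ Finset.Icc (-(B : ℤ)) B := by simp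
  have hsum := sum_Icc_two_pow_natAbs_le B
  rw [← Finset.add_sum_erase _ _ h0] at hsum ⊢
  have h1 : Real.exp (-codeCost δ 0) ≤ 1 - δ := by
    rw [codeCost, if_pos rfl]
    have := Real.quadratic_le_exp_of_nonneg (show 0 ≤ 2 * δ by positivity)
    rw [Real.exp_neg, inv_le_comm₀ (Real.exp_pos _) (by linarith)]
    refine le_trans ?_ this
    rw [inv_le_iff_one_le_mul₀ (by linarith)]
    nlinarith [mul_pos hδ hδ]
  have h2 : ∀ b ∈ (Finset.Icc (-(B : ℤ)) B).erase 0,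
      Real.exp (-codeCost δ b) = δ / 2 * (1 / 2) ^ b.natAbs := by
    intro b hb
    rw [codeCost, if_neg (Finset.ne_of_mem_erase hb), neg_add, Real.exp_add, Real.exp_neg,
      Real.exp_log (by positivity), inv_div, Real.exp_neg, Real.exp_nat_mul,
      Real.exp_log (by norm_num), one_div, inv_pow]
  rw [Finset.sum_congr rfl h2, ← Finset.mul_sum]
  have h3 : (0 : ℝ) < (1 / 2) ^ B := by positivity
  simp only [Int.natAbs_zero, pow_zero] at hsum
  nlinarith

/-- Rounding to a nonzero integer forces `|z| ≥ t/2`. With `x = z/t`, the cost is then at most of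
order `log t + x²`, while `decay t * z² = √t x²` dominates it. The exponent `-3/2` lies below `-1`,
for integrability in the distance, and above `-2`, for this domination. -/
theorem codeCost_floor_le {t : ℝ} (ht : 1 < t) (z : ℝ) :
    codeCost (decay t / 2) ⌊z / t + 1 / 2⌋ ≤ decay t * (1 + 12 * z ^ 2) := by
  have ht0 : 0 < t := by linarith
  have hd0 := decay_pos t
  have hd : decay t = t ^ (-(3 / 2) : ℝ) := by rw [decay, if_neg (not_le.2 ht)]
  unfold codeCost
  split_ifs with h
  · nlinarith [mul_nonneg hd0.le (sq_nonneg z)]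
  · set x := z / t with hx
    have hx1 : 1 / 2 ≤ |x| := by
      by_contra hcon
      push Not at hcon
      rw [abs_lt] at hcon
      apply h
      rw [Int.floor_eq_zero_iff]
      constructor <;> linarith [hcon.1, hcon.2]
    have hb : ((⌊x + 1 / 2⌋.natAbs : ℕ) : ℝ) ≤ 4 * x ^ 2 := by
      rw [Nat.cast_natAbs, Int.cast_abs]
      have h1 : |(⌊x + 1 / 2⌋ : ℝ)| ≤ |x| + 1 / 2 := by
        have h2 := Int.floor_le (x + 1 / 2)
        have h3 := Int.lt_floor_add_one (x + 1 / 2)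
        rw [abs_le]
        constructor <;> linarith [neg_abs_le x, le_abs_self x]
      rw [← sq_abs x]
      nlinarith
    have hlog2 : Real.log 2 ≤ 7 / 10 := by linarith [Real.log_two_lt_d9]
    have hlog20 : 0 ≤ Real.log 2 := Real.log_nonneg (by norm_num)
    have hs : 0 < Real.sqrt t := Real.sqrt_pos.2 ht0
    have hlog : Real.log (2 / (decay t / 2)) ≤ 3 * Real.sqrt t - 8 / 5 := by
      have h1 : (2 : ℝ) / (decay t / 2) = 2 * 2 * t ^ (3 / 2 : ℝ) := by
        rw [hd, Real.rpow_neg ht0.le]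
        field_simp
      have h2 : Real.log t ≤ 2 * (Real.sqrt t - 1) := by
        have := Real.log_le_sub_one_of_pos hs
        rw [Real.log_sqrt ht0.le] at this
        linarith
      rw [h1, Real.log_mul (by norm_num) (by positivity), Real.log_mul (by norm_num) (by norm_num),
        Real.log_rpow ht0]
      linarith
    have hdx : decay t * z ^ 2 = Real.sqrt t * x ^ 2 := by
      have h1 : t ^ (-(3 / 2) : ℝ) * t ^ 2 = Real.sqrt t := by
        rw [← Real.rpow_natCast t 2, ← Real.rpow_add ht0, Real.sqrt_eq_rpow]
        norm_num
      rw [hd, ← h1, hx, div_pow]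
      field_simp
    have hx2 : 1 ≤ 4 * x ^ 2 := by
      rw [← sq_abs x]; nlinarith
    have h3 : (3 * Real.sqrt t - 8 / 5) + 4 * x ^ 2 * (7 / 10) ≤ 12 * (Real.sqrt t * x ^ 2) := by
      have hs1 : 1 ≤ Real.sqrt t := Real.one_le_sqrt.2 ht.le
      nlinarith [mul_le_mul_of_nonneg_left hx2 hs.le]
    have h4 : (⌊x + 1 / 2⌋.natAbs : ℝ) * Real.log 2 ≤ 4 * x ^ 2 * (7 / 10) := by gcongr
    nlinarith

/-- By Markov, patterns of cost below `2K` carry at least half the mass; by Kraft there are at most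
`exp(2K)` of them. Were each lighter than `exp(-2K)/4`, the total mass would be at most `3/4`. -/
theorem exists_pattern_measure_ge {V ι : Type*} [MeasurableSpace V] [Fintype ι] {ν : Measure V}
    [IsProbabilityMeasure ν] {b : V → ι → ℤ} (hb : Measurable b) {B : ℕ}
    (hbB : ∀ u i, b u i ∈ Finset.Icc (-(B : ℤ)) B) {δ : ι → ℝ} (hδ : ∀ i, 0 < δ i)
    (hδ1 : ∀ i, δ i ≤ 1 / 2) {K : ℝ} (hK : 0 < K)
    (hcost : ∫⁻ u, ENNReal.ofReal (∑ i, codeCost (δ i) (b u i)) ∂ν ≤ ENNReal.ofReal K) :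
    ∃ β, ENNReal.ofReal (Real.exp (-2 * K) / 4) ≤ ν (b ⁻¹' {β}) := by
  classical
  by_contra hcon
  push Not at hcon
  set cost : (ι → ℤ) → ℝ := fun β => ∑ i, codeCost (δ i) (β i) with hcostdef
  have hcm : Measurable fun u => ENNReal.ofReal (cost (b u)) :=
    (measurable_of_countable fun β => ENNReal.ofReal (cost β)).comp hb
  have hmarkov : ν {u | ENNReal.ofReal (2 * K) ≤ ENNReal.ofReal (cost (b u))} ≤
      ENNReal.ofReal (1 / 2) := by
    have h1 := mul_meas_ge_le_lintegral (μ := ν) hcm (ENNReal.ofReal (2 * K))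
    have h2 := h1.trans hcost
    rw [← ENNReal.ofReal_toReal (measure_ne_top ν _), ← ENNReal.ofReal_mul (by positivity),
      ENNReal.ofReal_le_ofReal_iff hK.le] at h2
    rw [← ENNReal.ofReal_toReal (measure_ne_top ν _)]
    apply ENNReal.ofReal_le_ofReal
    nlinarith
  set S : Finset (ι → ℤ) := (Fintype.piFinset fun _ => Finset.Icc (-(B : ℤ)) B).filter
    (fun β => cost β < 2 * K) with hS
  have hcover : (Set.univ : Set V) ⊆ {u | ENNReal.ofReal (2 * K) ≤ ENNReal.ofReal (cost (b u))} ∪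
      ⋃ β ∈ S, b ⁻¹' {β} := by
    intro u _
    by_cases hu : cost (b u) < 2 * K
    · right
      refine Set.mem_iUnion₂.2 ⟨b u, ?_, rfl⟩
      exact Finset.mem_filter.2 ⟨Fintype.mem_piFinset.2 fun i => hbB u i, hu⟩
    · left
      exact ENNReal.ofReal_le_ofReal (not_lt.1 hu)
  have hSsum : ∑ β ∈ S, Real.exp (-2 * K) ≤ 1 := by
    calc _ ≤ ∑ β ∈ S, Real.exp (-cost β) := by
          refine Finset.sum_le_sum fun β hβ => Real.exp_le_exp.2 ?_
          have := (Finset.mem_filter.1 hβ).2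
          linarith
      _ ≤ ∑ β ∈ Fintype.piFinset fun _ : ι => Finset.Icc (-(B : ℤ)) B, Real.exp (-cost β) :=
          Finset.sum_le_sum_of_subset_of_nonneg (Finset.filter_subset _ _)
            fun _ _ _ => (Real.exp_pos _).le
      _ = ∏ i, ∑ x ∈ Finset.Icc (-(B : ℤ)) B, Real.exp (-codeCost (δ i) x) := by
          rw [Finset.prod_univ_sum]
          refine Finset.sum_congr rfl fun β _ => ?_
          rw [hcostdef, ← Finset.sum_neg_distrib, Real.exp_sum]
      _ ≤ 1 := Finset.prod_le_one (fun i _ => Finset.sum_nonneg fun _ _ => (Real.exp_pos _).le)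
          fun i _ => sum_exp_neg_codeCost_le (hδ i) (hδ1 i) B
  have hone : (1 : ℝ≥0∞) ≤ ENNReal.ofReal (1 / 2) + ENNReal.ofReal (1 / 4) := by
    calc (1 : ℝ≥0∞) = ν Set.univ := measure_univ.symm
      _ ≤ _ := (measure_mono hcover).trans (measure_union_le _ _)
      _ ≤ ENNReal.ofReal (1 / 2) + ∑ β ∈ S, ENNReal.ofReal (Real.exp (-2 * K) / 4) := by
          refine add_le_add hmarkov ((measure_biUnion_finset_le _ _).trans
            (Finset.sum_le_sum fun β _ => (hcon β).le))
      _ ≤ _ := by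
          rw [← ENNReal.ofReal_sum_of_nonneg fun _ _ => by positivity, ← Finset.sum_div]
          gcongr
  rw [← ENNReal.ofReal_add (by norm_num) (by norm_num), ENNReal.one_le_ofReal] at hone
  norm_num at hone

theorem exists_abs_inner_lt_of_one_lt {W : Type*} [NormedAddCommGroup W] [InnerProductSpace ℝ W]
    [FiniteDimensional ℝ W] (hW : 0 < Module.finrank ℝ W) {ι : Type*} [Fintype ι]
    (y : ι → W) (t : ι → ℝ) (ht : ∀ i, 1 < t i) {K : ℝ} (hK : 0 < K)
    (hsum : ∑ i, decay (t i) * (1 + 12 * (‖y i‖ ^ 2 / Module.finrank ℝ W)) ≤ K)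
    (hKd : Real.exp (-(3 / 32) * Module.finrank ℝ W) < Real.exp (-2 * K) / 4) :
    ∃ v : W, 1 ≤ ‖v‖ ∧ ‖v‖ ≤ 2 ∧ ∀ i, |inner ℝ (y i) v| < t i := by
  borelize W
  have : Nontrivial W := Module.nontrivial_of_finrank_pos hW
  set b : Metric.sphere (0 : W) 1 → ι → ℤ := fun u i =>
    ⌊inner ℝ (u : W) (y i) / t i + 1 / 2⌋ with hb
  have hbm : Measurable b := measurable_pi_lambda _ fun i =>
    Int.measurable_floor.comp (((measurable_inner_sphere (y i)).div_const _).add_const _)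
  obtain ⟨B, hB⟩ : ∃ B : ℕ, ∀ u i, b u i ∈ Finset.Icc (-(B : ℤ)) B := by
    obtain ⟨M, hM⟩ := exists_nat_ge (∑ i, ‖y i‖)
    refine ⟨M + 1, fun u i => ?_⟩
    have h1 : |inner ℝ (u : W) (y i) / t i| ≤ M := by
      rw [abs_div, abs_of_pos (by linarith [ht i] : 0 < t i), div_le_iff₀ (by linarith [ht i])]
      have h2 := abs_real_inner_le_norm (u : W) (y i)
      rw [norm_eq_of_mem_sphere u, one_mul] at h2
      have h3 : ‖y i‖ ≤ M := (Finset.single_le_sum (f := fun i => ‖y i‖)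
        (fun _ _ => norm_nonneg _) (Finset.mem_univ i)).trans hM
      nlinarith [ht i, Nat.cast_nonneg (α := ℝ) M]
    rw [abs_le] at h1
    rw [Finset.mem_Icc]
    constructor
    · rw [hb]
      apply Int.le_floor.2
      push_cast
      linarith
    · rw [hb]
      apply Int.lt_add_one_iff.1
      apply Int.floor_lt.2
      push_cast
      linarith
  have hcost : ∫⁻ u, ENNReal.ofReal (∑ i, codeCost (decay (t i) / 2) (b u i)) ∂usphere W ≤
      ENNReal.ofReal K := by
    have hpt : ∀ u : Metric.sphere (0 : W) 1,
        ENNReal.ofReal (∑ i, codeCost (decay (t i) / 2) (b u i)) ≤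
        ∑ i, ENNReal.ofReal (decay (t i)) * (1 + ENNReal.ofReal 12 *
          ENNReal.ofReal (inner ℝ (u : W) (y i) ^ 2)) := by
      intro u
      refine (ENNReal.ofReal_le_ofReal (Finset.sum_le_sum fun i _ =>
        codeCost_floor_le (ht i) (inner ℝ (u : W) (y i)))).trans (le_of_eq ?_)
      rw [ENNReal.ofReal_sum_of_nonneg fun i _ => by have := decay_pos (t i); positivity]
      refine Finset.sum_congr rfl fun i _ => ?_
      rw [ENNReal.ofReal_mul (decay_pos _).le, ENNReal.ofReal_add zero_le_one (by positivity),
        ENNReal.ofReal_one, ENNReal.ofReal_mul (by norm_num)]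
    refine (lintegral_mono hpt).trans ?_
    have hm : ∀ i, Measurable fun u : Metric.sphere (0 : W) 1 =>
        ENNReal.ofReal (inner ℝ (u : W) (y i) ^ 2) := fun i =>
      ((measurable_inner_sphere (y i)).pow_const 2).ennreal_ofReal
    rw [lintegral_finsetSum _ fun i _ => (((hm i).const_mul _).const_add 1).const_mul _]
    refine le_trans (le_of_eq ?_) (ENNReal.ofReal_le_ofReal hsum)
    rw [ENNReal.ofReal_sum_of_nonneg fun i _ => by have := decay_pos (t i); positivity]
    refine Finset.sum_congr rfl fun i _ => ?_
    rw [lintegral_const_mul _ (((hm i).const_mul _).const_add 1),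
      lintegral_add_left measurable_const, lintegral_const_mul _ (hm i),
      lintegral_usphere_inner_sq, lintegral_one, measure_univ,
      ENNReal.ofReal_mul (decay_pos _).le, ENNReal.ofReal_add zero_le_one (by positivity),
      ENNReal.ofReal_one, ENNReal.ofReal_mul (by norm_num)]
  obtain ⟨β, hβ⟩ := exists_pattern_measure_ge hbm hB (fun i => half_pos (decay_pos (t i)))
    (fun i => by linarith [decay_le_one (t i)]) hK hcost
  have hlt : ENNReal.ofReal (Real.exp (-(3 / 32) * Module.finrank ℝ W)) <
      usphere W (b ⁻¹' {β}) :=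
    lt_of_lt_of_le ((ENNReal.ofReal_lt_ofReal_iff (by positivity)).2 hKd) hβ
  obtain ⟨u, hu⟩ : (b ⁻¹' {β}).Nonempty := by
    rw [Set.nonempty_iff_ne_empty]
    intro h
    rw [h, measure_empty] at hlt
    exact not_lt_zero hlt
  -- Otherwise the whole pattern lies in the cap `⟨w,u⟩ ≥ 1/2`, of mass at most `exp(-3d/32)`, which
  -- is too small.
  obtain ⟨w, hw, hwu⟩ : ∃ w ∈ b ⁻¹' {β}, 1 ≤ ‖(w : W) - u‖ := by
    by_contra hcon
    push Not at hcon
    refine absurd hlt (not_lt.2 ?_)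
    have hcap := usphere_cap_le (norm_eq_of_mem_sphere u) (show (0 : ℝ) ≤ 1 / 2 by norm_num)
    refine (measure_mono fun w hw => ?_).trans (hcap.trans (le_of_eq ?_))
    · have h1 := hcon w hw
      have h2 := norm_sub_sq_real (w : W) (u : W)
      rw [norm_eq_of_mem_sphere w, norm_eq_of_mem_sphere u] at h2
      change 1 / 2 ≤ inner ℝ (w : W) (u : W)
      nlinarith [norm_nonneg ((w : W) - u)]
    · congr 2; ring
  refine ⟨(w : W) - u, hwu, ?_, fun i => ?_⟩
  · refine (norm_sub_le _ _).trans ?_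
    rw [norm_eq_of_mem_sphere w, norm_eq_of_mem_sphere u]
    norm_num
  · have hti : 0 < t i := by linarith [ht i]
    have hwb : b w = β := hw
    have hub : b u = β := hu
    have h1 : ⌊inner ℝ (w : W) (y i) / t i + 1 / 2⌋ = ⌊inner ℝ (u : W) (y i) / t i + 1 / 2⌋ :=
      congrFun (hwb.trans hub.symm) i
    have h2 := Int.abs_sub_lt_one_of_floor_eq_floor h1
    rw [add_sub_add_right_eq_sub, ← sub_div, abs_div, abs_of_pos hti, div_lt_one hti] at h2
    rw [inner_sub_right, real_inner_comm, real_inner_comm (u : W)]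
    exact h2

/-- Each constraint with `t i ≤ 1` costs at least one unit of the sum, so there are at most
`m/3072`; they are met exactly by passing to the common kernel `W`. Since `dim W ≥ m/2`, the entropy
bound for the others grows by at most `24`, whence `K = m/128`. -/
theorem exists_abs_inner_lt {V : Type*} [NormedAddCommGroup V] [InnerProductSpace ℝ V]
    [FiniteDimensional ℝ V] (hV : 64 ≤ Module.finrank ℝ V) {ι : Type*} [Fintype ι]
    (y : ι → V) (t : ι → ℝ) (ht : ∀ i, 0 < t i)
    (hsum : ∑ i, decay (t i) * (1 + ‖y i‖ ^ 2 / Module.finrank ℝ V) ≤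
      (Module.finrank ℝ V : ℝ) / 3072) :
    ∃ v : V, 1 ≤ ‖v‖ ∧ ‖v‖ ≤ 2 ∧ ∀ i, |inner ℝ (y i) v| < t i := by
  classical
  set m : ℝ := (Module.finrank ℝ V : ℝ) with hm
  have hm64 : 64 ≤ m := by rw [hm]; exact_mod_cast hV
  have hterm : ∀ i, 0 ≤ decay (t i) * (1 + ‖y i‖ ^ 2 / m) := fun i =>
    mul_nonneg (decay_pos _).le (by positivity)
  set φ : V →ₗ[ℝ] ({i // t i ≤ 1} → ℝ) := LinearMap.pi fun i => (innerₛₗ ℝ (y i)) with hφ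
  set W : Submodule ℝ V := LinearMap.ker φ with hWdef
  have hcard : (Fintype.card {i // t i ≤ 1} : ℝ) ≤ m / 3072 := by
    refine le_trans ?_ hsum
    rw [Fintype.card_subtype, Finset.card_eq_sum_ones, Nat.cast_sum]
    refine le_trans ?_ (Finset.sum_le_sum_of_subset_of_nonneg
      (Finset.filter_subset (fun i => t i ≤ 1) Finset.univ) fun i _ _ => hterm i)
    refine Finset.sum_le_sum fun i hi => ?_
    rw [decay, if_pos (Finset.mem_filter.1 hi).2, one_mul, Nat.cast_one]
    exact le_add_of_nonneg_right (by positivity)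
  have hdim : m / 2 ≤ (Module.finrank ℝ W : ℝ) := by
    have h1 := LinearMap.finrank_range_add_finrank_ker φ
    rw [← hWdef] at h1
    have h2 : Module.finrank ℝ (LinearMap.range φ) ≤ Fintype.card {i // t i ≤ 1} := by
      refine (Submodule.finrank_le _).trans ?_
      rw [Module.finrank_fintype_fun_eq_card]
    have h3 : m ≤ (Fintype.card {i // t i ≤ 1} : ℝ) + (Module.finrank ℝ W : ℝ) := by
      rw [hm]
      exact_mod_cast (by omega)
    linarith
  have hW0 : 0 < Module.finrank ℝ W := by
    have : (0 : ℝ) < Module.finrank ℝ W := by linarith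
    exact_mod_cast this
  have hfar : ∑ i : {i // ¬ t i ≤ 1}, decay (t i) * (1 + 12 *
      (‖W.orthogonalProjectionOnto (y i)‖ ^ 2 / Module.finrank ℝ W)) ≤ m / 128 := by
    have h24 : 24 * ∑ i, decay (t i) * (1 + ‖y i‖ ^ 2 / m) ≤ m / 128 := by linarith
    refine le_trans ?_ h24
    rw [Finset.mul_sum, ← Fintype.sum_subtype_add_sum_subtype (fun i => t i ≤ 1)]
    refine le_trans (Finset.sum_le_sum fun i _ => ?_) (le_add_of_nonneg_left
      (Finset.sum_nonneg fun i _ => mul_nonneg (by norm_num) (hterm _)))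
    have h1 : ‖W.orthogonalProjectionOnto (y i)‖ ≤ ‖y i‖ :=
      (W.orthogonalProjectionOnto.le_opNorm _).trans (by
        have := W.orthogonalProjectionOnto_norm_le
        nlinarith [norm_nonneg (y i)])
    have h2 : ‖W.orthogonalProjectionOnto (y i)‖ ^ 2 / Module.finrank ℝ W ≤
        2 * (‖y i‖ ^ 2 / m) := by
      calc _ ≤ ‖y i‖ ^ 2 / (m / 2) := by gcongr
        _ = _ := by field_simp
    have h3 := decay_pos (t i)
    have h4 : 0 ≤ ‖y i‖ ^ 2 / m := by positivity
    nlinarith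
  have hexp : Real.exp (-(3 / 32) * Module.finrank ℝ W) < Real.exp (-2 * (m / 128)) / 4 := by
    rw [lt_div_iff₀ (by norm_num)]
    -- The dimension bound `64` enters here: `exp(m/32) ≥ e² > 4`.
    have h1 : (4 : ℝ) < Real.exp (m / 32) := by
      have h2 : Real.exp 1 ^ 2 ≤ Real.exp (m / 32) := by
        rw [← Real.exp_nat_mul]
        apply Real.exp_le_exp.2
        push_cast
        linarith
      have := Real.exp_one_gt_d9
      nlinarith
    calc _ ≤ Real.exp (-(3 / 64) * m) * 4 := by
          gcongr ?_ * 4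
          apply Real.exp_le_exp.2
          linarith
      _ < Real.exp (-(3 / 64) * m) * Real.exp (m / 32) := by gcongr
      _ = _ := by rw [← Real.exp_add]; congr 1; ring
  obtain ⟨v, hv1, hv2, hv⟩ := exists_abs_inner_lt_of_one_lt hW0
    (fun i : {i // ¬ t i ≤ 1} => W.orthogonalProjectionOnto (y i)) (fun i => t i)
    (fun i => not_le.1 i.2) (by linarith) hfar hexp
  refine ⟨v, hv1, hv2, fun i => ?_⟩
  by_cases hi : t i ≤ 1
  · have h1 : φ v = 0 := LinearMap.mem_ker.1 v.2
    have h2 : inner ℝ (y i) (v : V) = 0 := congrFun h1 ⟨i, hi⟩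
    rw [h2, abs_zero]
    exact ht i
  · have := hv ⟨i, hi⟩
    rwa [Submodule.inner_orthogonalProjectionOnto_eq_of_mem_right] at this

end PartialColoring

/-! ### The cell has a far point in the subspace. -/

section LowerBound

variable {n : ℕ}

local notation "E" => EuclideanSpace ℝ (Fin n)

theorem projSq_hyperplaneOf_eq_norm (L : Submodule ℝ E) {p : Metric.sphere (0 : E) 1 × ℝ}
    (hp : 0 ≤ p.2) :
    projSq L (hyperplaneOf n p) = ‖L.orthogonalProjectionOnto (p.1 : E)‖ ^ 2 := by
  rw [projSq_hyperplaneOf L hp, ← (stdOrthonormalBasis ℝ L).sum_sq_norm_inner_left]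
  refine Finset.sum_congr rfl fun k _ => ?_
  rw [Submodule.inner_orthogonalProjectionOnto_eq_of_mem_right, Real.norm_eq_abs, sq_abs]

theorem norm_orthogonalProjectionOnto_le_of_subspaceNear {L K : Submodule ℝ E} {η : ℝ}
    (hη : 0 ≤ η) (h : SubspaceNear η L K) {u : E} (hu : ‖u‖ = 1) :
    ‖L.orthogonalProjectionOnto u‖ ≤ ‖K.orthogonalProjectionOnto u‖ + η := by
  set y := L.orthogonalProjectionOnto u with hy
  by_cases hy0 : ‖y‖ = 0
  · rw [hy0]; positivity
  obtain ⟨w, hwK, hw1, hvw⟩ := h ((‖y‖⁻¹ • y : L) : E) (SetLike.coe_mem _)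
    (by
      change ‖(‖y‖⁻¹ • y : L)‖ = 1
      rw [norm_smul, norm_inv, norm_norm, inv_mul_cancel₀ hy0])
  have h1 : inner ℝ u ((‖y‖⁻¹ • y : L) : E) = ‖y‖ := by
    rw [← Submodule.inner_orthogonalProjectionOnto_eq_of_mem_right, ← hy, real_inner_smul_right,
      real_inner_self_eq_norm_sq]
    field_simp
  have h2 : inner ℝ u w ≤ ‖K.orthogonalProjectionOnto u‖ := by
    have h3 := Submodule.inner_orthogonalProjectionOnto_eq_of_mem_right (⟨w, hwK⟩ : K) u
    have h4 := real_inner_le_norm (K.orthogonalProjectionOnto u) ⟨w, hwK⟩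
    rw [h3] at h4
    have h5 : ‖(⟨w, hwK⟩ : K)‖ = 1 := hw1
    rwa [h5, mul_one] at h4
  have h6 := real_inner_le_norm u (((‖y‖⁻¹ • y : L) : E) - w)
  rw [inner_sub_right, h1, hu, one_mul] at h6
  linarith

/-- Projection norms of unit vectors grow by at most `1/(2√n)` from `K` to `L`, so `n|P u|²` at most
doubles up to an additive `1/2`, absorbed by the `1` in the weight. -/
theorem farWeight_le_of_subspaceNear [NeZero n] {L K : Submodule ℝ E}
    (hLK : Module.finrank ℝ L = Module.finrank ℝ K) (hK : 0 < Module.finrank ℝ K)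
    (h : SubspaceNear (1 / (2 * Real.sqrt n)) L K) (c T : ℝ) (H : Hyperplane n) :
    farWeight L c T H ≤ 2 * farWeight K c T H := by
  by_cases hH : H ∈ {H : Hyperplane n | H.dist 0 ≤ T}
  · rw [farWeight, farWeight, Set.indicator_of_mem hH, Set.indicator_of_mem hH, hLK]
    have hn0 : (0 : ℝ) < n := by exact_mod_cast Nat.pos_of_ne_zero (NeZero.ne n)
    have hm1 : (1 : ℝ) ≤ Module.finrank ℝ K := by exact_mod_cast hK
    set m : ℝ := (Module.finrank ℝ K : ℝ)
    have hproj : n * projSq L H ≤ 2 * (n * projSq K H) + 1 / 2 := by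
      obtain ⟨p, hp, rfl⟩ := H.exists_rep
      rw [projSq_hyperplaneOf_eq_norm L hp, projSq_hyperplaneOf_eq_norm K hp]
      have h1 := norm_orthogonalProjectionOnto_le_of_subspaceNear (by positivity) h
        (norm_coe_sphere p.1)
      set a := ‖L.orthogonalProjectionOnto (p.1 : E)‖
      set b := ‖K.orthogonalProjectionOnto (p.1 : E)‖
      set e : ℝ := 1 / (2 * Real.sqrt n) with he
      have he2 : n * e ^ 2 = 1 / 4 := by
        rw [he, div_pow, mul_pow, Real.sq_sqrt hn0.le]
        field_simp
        norm_num
      have h2 : a ^ 2 ≤ (b + e) ^ 2 := by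
        have : 0 ≤ a := norm_nonneg _
        gcongr
      nlinarith [mul_le_mul_of_nonneg_left (h2.trans
        (by nlinarith [sq_nonneg (b - e)] : (b + e) ^ 2 ≤ 2 * b ^ 2 + 2 * e ^ 2)) hn0.le]
    have h3 : n / m * projSq L H ≤ 2 * (n / m * projSq K H) + 1 := by
      rw [div_mul_eq_mul_div, div_mul_eq_mul_div]
      calc n * projSq L H / m ≤ (2 * (n * projSq K H) + 1 / 2) / m := by gcongr
        _ = 2 * (n * projSq K H / m) + 1 / 2 / m := by ring
        _ ≤ _ := by
          gcongr
          rw [div_le_one (by positivity)]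
          linarith
    have h4 := decay_pos (H.dist 0 / c)
    have h5 : (1 + n / m * projSq L H) / 8 ≤ 2 * ((1 + n / m * projSq K H) / 8) := by linarith
    calc _ ≤ decay (H.dist 0 / c) * (2 * ((1 + n / m * projSq K H) / 8)) := by gcongr
      _ = _ := by ring
  · rw [farWeight, farWeight, Set.indicator_of_notMem hH, Set.indicator_of_notMem hH, mul_zero]

theorem decay_antitone {s t : ℝ} (hst : s ≤ t) : decay t ≤ decay s := by
  by_cases hs : s ≤ 1
  · rw [decay.eq_def s, if_pos hs]
    exact decay_le_one t
  · push Not at hs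
    rw [decay, decay, if_neg (not_le.2 hs), if_neg (not_le.2 (hs.trans_le hst))]
    exact Real.rpow_le_rpow_of_nonpos (by linarith) hst (by norm_num)

/-- In units of `c = s/√n` the constraints become those of `exists_abs_inner_lt` for `√n P_L u`. The
point is `s v` with `1 ≤ ‖v‖ ≤ 2`, so hyperplanes farther than `2s` are avoided automatically. The
constant is `49152 = 2 · 8 · 3072`: the passage from `K` to `L`, the factor `1/8` of the weight, and
the entropy threshold. -/
theorem exists_mem_zeroCell_le_norm [NeZero n] {s : ℝ} (hs : 0 < s) {L K : Submodule ℝ E}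
    (hLK : Module.finrank ℝ L = Module.finrank ℝ K) (hK : 64 ≤ Module.finrank ℝ K)
    (hnear : SubspaceNear (1 / (2 * Real.sqrt n)) L K)
    {ι : Type} [Countable ι] {h : ι → Hyperplane n} {μ : Measure (Hyperplane n)}
    (hμ : μ = Measure.sum fun i => Measure.dirac (h i))
    (hfar : ∫⁻ H, ENNReal.ofReal (farWeight K (s / Real.sqrt n) (2 * s) H) ∂μ ≤
      ENNReal.ofReal (Module.finrank ℝ K / 49152))
    (hμ0 : μ {H | H.dist 0 ≤ 0} = 0) : ∃ x ∈ zeroCell μ, x ∈ L ∧ s ≤ ‖x‖ := by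
  classical
  have hn0 : 0 < Real.sqrt n := Real.sqrt_pos.2 (by exact_mod_cast Nat.pos_of_ne_zero (NeZero.ne n))
  set c : ℝ := s / Real.sqrt n with hc
  have hc0 : 0 < c := by positivity
  set m : ℝ := (Module.finrank ℝ K : ℝ) with hm
  have hmL : (Module.finrank ℝ L : ℝ) = m := by rw [hLK]
  have hsum : ∑' i, ENNReal.ofReal (farWeight L c (2 * s) (h i)) ≤ ENNReal.ofReal (m / 24576) := by
    have h1 : ∀ i, ENNReal.ofReal (farWeight L c (2 * s) (h i)) ≤
        ENNReal.ofReal 2 * ENNReal.ofReal (farWeight K c (2 * s) (h i)) := fun i => by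
      rw [← ENNReal.ofReal_mul (by norm_num)]
      exact ENNReal.ofReal_le_ofReal (farWeight_le_of_subspaceNear hLK (by omega) hnear _ _ _)
    have h2 : ∫⁻ H, ENNReal.ofReal (farWeight K c (2 * s) H) ∂μ =
        ∑' i, ENNReal.ofReal (farWeight K c (2 * s) (h i)) := by
      rw [hμ, lintegral_sum_measure]
      exact tsum_congr fun i => lintegral_dirac' _ (measurable_farWeight K c _).ennreal_ofReal
    refine (ENNReal.tsum_le_tsum h1).trans ?_
    rw [ENNReal.tsum_mul_left, ← h2]
    calc _ ≤ ENNReal.ofReal 2 * ENNReal.ofReal (m / 49152) := by gcongr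
      _ = _ := by
        rw [← ENNReal.ofReal_mul (by norm_num)]
        congr 1; ring
  have hd0 : ∀ i, 0 < (h i).dist 0 := by
    intro i
    by_contra hcon
    refine sum_dirac_singleton_ne_zero h i ?_
    rw [← hμ]
    exact measure_mono_null (t := {H : Hyperplane n | H.dist 0 ≤ 0})
      (Set.singleton_subset_iff.2 (show (h i).dist 0 ≤ 0 from not_lt.1 hcon)) hμ0
  choose p hp hph using fun i => (h i).exists_rep
  have hfw : ∀ i, (h i).dist 0 ≤ 2 * s → farWeight L c (2 * s) (h i) =
      decay ((h i).dist 0 / c) * ((1 + n / m * projSq L (h i)) / 8) := fun i hi => by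
    rw [farWeight, Set.indicator_of_mem (by exact hi), hmL]
  -- Each hyperplane within `2s` has weight at least `decay (2s/c) / 8`, and the total weight is
  -- finite.
  have hfin : {i | (h i).dist 0 ≤ 2 * s}.Finite := by
    refine (ENNReal.finite_const_le_of_tsum_ne_top (ne_top_of_le_ne_top ENNReal.ofReal_ne_top hsum)
      (ε := ENNReal.ofReal (decay (2 * s / c) / 8))
      (by simpa using decay_pos (2 * s / c))).subset fun i hi => ?_
    apply ENNReal.ofReal_le_ofReal
    have hi' : (h i).dist 0 ≤ 2 * s := hi
    rw [hfw i hi']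
    have h1 : decay (2 * s / c) ≤ decay ((h i).dist 0 / c) := decay_antitone (by gcongr)
    have h2 : 0 ≤ n / m * projSq L (h i) := mul_nonneg (by positivity) (projSq_nonneg _ _)
    have h3 := decay_pos (2 * s / c)
    nlinarith
  have := hfin.fintype
  have hV : 64 ≤ Module.finrank ℝ L := by omega
  obtain ⟨v, hv1, hv2, hv⟩ := exists_abs_inner_lt hV
    (fun i : {i | (h i).dist 0 ≤ 2 * s} =>
      Real.sqrt n • L.orthogonalProjectionOnto ((p i).1 : E))
    (fun i => (h i).dist 0 / c) (fun i => div_pos (hd0 i) hc0) (by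
      have h1 : ∑ i : {i | (h i).dist 0 ≤ 2 * s}, ENNReal.ofReal (farWeight L c (2 * s) (h i)) ≤
          ENNReal.ofReal (m / 24576) := by
        refine le_trans ?_ hsum
        have h2 := tsum_fintype (L := SummationFilter.unconditional _)
          fun i : {i | (h i).dist 0 ≤ 2 * s} => ENNReal.ofReal (farWeight L c (2 * s) (h i))
        refine le_trans (le_of_eq h2.symm) ?_
        exact ENNReal.tsum_comp_le_tsum_of_injective Subtype.val_injective
          fun i => ENNReal.ofReal (farWeight L c (2 * s) (h i))
      have hnn : ∀ i : {i | (h i).dist 0 ≤ 2 * s}, 0 ≤ farWeight L c (2 * s) (h i) := fun i => by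
        rw [hfw i i.2]
        have h2 : 0 ≤ n / m * projSq L (h i) := mul_nonneg (by positivity) (projSq_nonneg _ _)
        have h3 := decay_pos ((h i).dist 0 / c)
        positivity
      rw [← ENNReal.ofReal_sum_of_nonneg fun i _ => hnn i,
        ENNReal.ofReal_le_ofReal_iff (by positivity)] at h1
      rw [hmL]
      have h8 : 8 * ∑ i : {i | (h i).dist 0 ≤ 2 * s}, farWeight L c (2 * s) (h i) ≤ m / 3072 := by
        linarith
      refine le_trans (le_of_eq ?_) h8
      rw [Finset.mul_sum]
      refine Finset.sum_congr rfl fun i _ => ?_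
      rw [hfw i i.2]
      have h9 : projSq L (h i) = ‖L.orthogonalProjectionOnto ((p i).1 : E)‖ ^ 2 := by
        rw [← projSq_hyperplaneOf_eq_norm L (hp i), hph]
      rw [h9, norm_smul, mul_pow, Real.norm_eq_abs, sq_abs, Real.sq_sqrt (Nat.cast_nonneg n)]
      ring)
  have hxn : ‖s • (v : E)‖ = s * ‖v‖ := by
    rw [norm_smul, Real.norm_eq_abs, abs_of_pos hs]; rfl
  refine ⟨s • (v : E), mem_zeroCell_of_absInner_lt fun H hH => ?_, L.smul_mem _ v.2, ?_⟩
  · rw [hμ] at hH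
    obtain ⟨i, rfl⟩ := exists_eq_of_sum_dirac_ne_zero h hH
    by_cases hi : (h i).dist 0 ≤ 2 * s
    · have h1 := hv ⟨i, hi⟩
      have h3 : inner ℝ (Real.sqrt n • L.orthogonalProjectionOnto ((p i).1 : E)) v =
          Real.sqrt n * inner ℝ ((p i).1 : E) (v : E) :=
        (real_inner_smul_left _ _ _).trans
          (by rw [Submodule.inner_orthogonalProjectionOnto_eq_of_mem_right])
      change |inner ℝ (Real.sqrt n • L.orthogonalProjectionOnto ((p i).1 : E)) v| < _ at h1
      rw [h3, abs_mul, abs_of_pos hn0, lt_div_iff₀ hc0, hc] at h1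
      have h2 : (h i).absInner (s • (v : E)) = s * |inner ℝ ((p i).1 : E) (v : E)| := by
        rw [absInner_smul, abs_of_pos hs, ← hph i, absInner_hyperplaneOf (hp i)]
      rw [h2]
      refine lt_of_eq_of_lt ?_ h1
      field_simp
    · refine lt_of_le_of_lt (absInner_le_norm _ _) (lt_of_le_of_lt ?_ (not_le.1 hi))
      rw [hxn]
      nlinarith
  · rw [hxn]
    nlinarith

theorem IsPoissonProcess.measure_ne_zero_eq_zero {Ω S : Type*} [MeasurableSpace Ω]
    [MeasurableSpace S] {P : Measure Ω} [IsProbabilityMeasure P] {X : Ω → Measure S}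
    {Θ : Measure S} (hX : IsPoissonProcess P X Θ) {A : Set S} (hA : MeasurableSet A)
    (hΘ : Θ A = 0) : P {ω | X ω A ≠ 0} = 0 := by
  have h := hX.poisson 1 (fun _ => A) (fun _ => 0) (fun _ => hA)
    (fun i k hik => (hik (Subsingleton.elim _ _)).elim) (fun _ => by simp [hΘ])
  have hm : MeasurableSet {ω | X ω A = 0} := hX.measurable_apply hA (measurableSet_singleton _)
  have h1 : P {ω | X ω A = 0} = 1 := by simpa [hΘ] using h
  exact (prob_compl_eq_zero_iff hm).2 h1

theorem exists_measure_circumradius_le : ∃ c C : ℝ, 0 < c ∧ 0 < C ∧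
    ∀ (n : ℕ) [NeZero n] (γ r : ℝ) (m : ℕ) (Ω : Type*) [MeasurableSpace Ω] (P : Measure Ω)
      [IsProbabilityMeasure P] (X : Ω → Measure (Hyperplane n))
      (L : Ω → Submodule ℝ (EuclideanSpace ℝ (Fin n))), 0 ≤ γ → 0 < r → 64 ≤ m →
      IsPoissonProcess P X (hyperplaneIntensity n γ) → Measurable L →
      (∀ ω, Module.finrank ℝ (L ω) = m) → IndepFun X L P →
      P {ω | circumradius (zeroCell (X ω) ∩ (L ω : Set (EuclideanSpace ℝ (Fin n)))) ≤
          ENNReal.ofReal r} ≤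
        ENNReal.ofReal (Real.exp (C * (γ * r / Real.sqrt n) - c * m)) := by
  have hC := one_le_sphereExpConst
  refine ⟨1 / 49152, 4 * (3 * Real.exp (1 / 8) * sphereExpConst), by norm_num, by positivity, ?_⟩
  intro n _ γ r m Ω _ P _ X L hγ hr hm64 hX hL hm hind
  have hn0 : 0 < Real.sqrt n := Real.sqrt_pos.2 (by exact_mod_cast Nat.pos_of_ne_zero (NeZero.ne n))
  set c : ℝ := 2 * r / Real.sqrt n with hc
  have hc0 : 0 < c := by positivity
  set T : ℝ := 2 * (2 * r) with hT
  set B : Submodule ℝ (EuclideanSpace ℝ (Fin n)) → Set (Measure (Hyperplane n)) := fun K =>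
    {μ | ENNReal.ofReal (m / 49152) < ∫⁻ H, ENNReal.ofReal (farWeight K c T H) ∂μ} ∪
      {μ | μ {H | H.dist 0 ≤ 0} ≠ 0} with hB
  refine measure_le_of_forall_subspaceNear hL hind
    (show (0 : ℝ) < 1 / (2 * Real.sqrt n) by positivity) B ?_ hm ?_ ?_
  · intro K
    refine MeasurableSet.union ?_ ?_
    · exact measurableSet_lt measurable_const
        (Measure.measurable_lintegral (measurable_farWeight K c T).ennreal_ofReal)
    · exact (Measure.measurable_coe (measurableSet_dist_zero_le 0) (measurableSet_singleton 0)).compl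
  · intro K hK
    have h1 : P {ω | ENNReal.ofReal (m / 49152) <
        ∫⁻ H, ENNReal.ofReal (farWeight K c T H) ∂(X ω)} ≤ ENNReal.ofReal (Real.exp
          (2 * γ * c * (3 * Real.exp (1 / 8) * sphereExpConst) - m / 49152)) :=
      hX.upper_tail (hyperplaneIntensity_dist_ne_top γ T) (measurable_farWeight K c T)
        (fun H hH => Set.indicator_of_notMem hH _) (by positivity) (by positivity)
        (lintegral_exp_farWeight_le hγ hc0 (by omega))
    have h2 : P {ω | X ω {H | H.dist 0 ≤ 0} ≠ 0} = 0 := by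
      refine hX.measure_ne_zero_eq_zero (measurableSet_dist_zero_le 0) (le_antisymm ?_ zero_le)
      simpa using hyperplaneIntensity_dist_le (n := n) γ 0
    rw [hB, Set.preimage_union]
    refine (measure_union_le _ _).trans ((add_le_add h1 h2.le).trans (le_of_eq ?_))
    rw [add_zero]
    congr 2
    rw [hc]; ring
  · intro ω hω K hK hLK
    by_contra hcon
    obtain ⟨ι, _, h, hμ⟩ := hX.counting ω
    have hg1 : ∫⁻ H, ENNReal.ofReal (farWeight K c T H) ∂(X ω) ≤ ENNReal.ofReal (m / 49152) := by
      by_contra hc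
      exact hcon (Or.inl (not_le.1 hc))
    have hg2 : X ω {H | H.dist 0 ≤ 0} = 0 := by
      by_contra hc
      exact hcon (Or.inr hc)
    obtain ⟨x, hx, hxL, hxs⟩ := exists_mem_zeroCell_le_norm (s := 2 * r) (by positivity)
      ((hm ω).trans hK.symm) (by omega) hLK hμ (by rw [hK]; exact hg1) hg2
    exact absurd hω (not_le.2 (lt_circumradius_of_mem hr
      (show x ∈ zeroCell (X ω) ∩ (L ω : Set (EuclideanSpace ℝ (Fin n))) from ⟨hx, hxL⟩) hxs))

end LowerBound

/-! ### The thresholds and the two limits. -/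

theorem mainTheorem11 (R : ℝ) (hR : 0 < R) :
    ∃ ρu : ℝ, 0 < ρu ∧ ∃ ρl : ℝ, 0 < ρl ∧
      ∀ (α ρ : ℝ) (m : ℕ → ℕ) (γ : ℕ → ℝ)
        (Ω : ℕ → Type*) [∀ n, MeasurableSpace (Ω n)]
        (P : ∀ n, Measure (Ω n)) [∀ n, IsProbabilityMeasure (P n)]
        (X : ∀ n, Ω n → Measure (Hyperplane n))
        (L : ∀ n, Ω n → Submodule ℝ (EuclideanSpace ℝ (Fin n))),
        (∀ n, 1 ≤ n → m n < n) →
        Tendsto m atTop atTop →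
        (∀ n, 1 ≤ n → 0 < γ n) →
        γ ~[atTop] (fun n : ℕ => ρ * (n : ℝ) ^ (α - 1) * (m n : ℝ)) →
        (∀ n, 1 ≤ n → IsStationaryIsotropicPoissonHyperplaneProcess (P n) (X n) (γ n)) →
        (∀ n, 1 ≤ n → Measurable (L n)) →
        (∀ n, 1 ≤ n → ∀ ω, Module.finrank ℝ (L n ω) = m n) →
        (∀ n, 1 ≤ n → IndepFun (X n) (L n) (P n)) →
        (ρu < ρ →
          Tendsto (fun n : ℕ => P n {ω |
              ENNReal.ofReal ((n : ℝ) ^ (3 / 2 - α) * R) ≤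
                circumradius (zeroCell (X n ω) ∩ (L n ω : Set (EuclideanSpace ℝ (Fin n))))})
            atTop (𝓝 0)) ∧
        (ρ < ρl →
          Tendsto (fun n : ℕ => P n {ω |
              circumradius (zeroCell (X n ω) ∩ (L n ω : Set (EuclideanSpace ℝ (Fin n)))) ≤
                ENNReal.ofReal ((n : ℝ) ^ (3 / 2 - α) * R)})
            atTop (𝓝 0)) := by
  obtain ⟨c, D, hc, hD, hup⟩ := exists_measure_norm_gt_le
  obtain ⟨c', C', hc', hC', hlow⟩ := exists_measure_circumradius_le
  have hlogD : 0 ≤ Real.log D := Real.log_nonneg hD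
  -- Eventually `γκ` with `κ = n^(3/2-α)/√n` lies between `ρm/2` and `3ρm/2`. The first bound, at
  -- radius `r/2`, has exponent at most `m log D - cρmR/8`, hence at most `-m`; the second has
  -- exponent at most `(3/2)C'ρmR - c'm`, hence at most `-c'm/2`.
  refine ⟨8 * (Real.log D + 1) / (c * R), by positivity, c' / (3 * C' * R), by positivity, ?_⟩
  intro α ρ m γ Ω _ P _ X L hmn hm hγ hγρ hX hL hdim hind
  have hexp : ∀ b : ℝ, 0 < b → Tendsto (fun n => ENNReal.ofReal (2 * Real.exp (-(b * (m n : ℝ)))))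
      atTop (𝓝 0) := by
    intro b hb
    have h1 : Tendsto (fun n => 2 * Real.exp (-(b * (m n : ℝ)))) atTop (𝓝 (2 * 0)) :=
      (Real.tendsto_exp_neg_atTop_nhds_zero.comp
        ((tendsto_natCast_atTop_atTop.comp hm).const_mul_atTop hb)).const_mul 2
    rw [mul_zero] at h1
    simpa using ENNReal.tendsto_ofReal h1
  have hpow : ∀ n : ℕ, 1 ≤ n → (n : ℝ) ^ (3 / 2 - α) / Real.sqrt n * (n : ℝ) ^ (α - 1) = 1 := by
    intro n hn
    have hn0 : (0 : ℝ) < n := by exact_mod_cast hn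
    rw [Real.sqrt_eq_rpow, ← Real.rpow_sub hn0, ← Real.rpow_add hn0]
    convert Real.rpow_zero _ using 2
    ring
  have hclose : ∀ᶠ n in atTop, |γ n - ρ * (n : ℝ) ^ (α - 1) * (m n : ℝ)| ≤
      1 / 2 * |ρ * (n : ℝ) ^ (α - 1) * (m n : ℝ)| := by
    simpa using hγρ.isLittleO.def (show (0 : ℝ) < 1 / 2 by norm_num)
  have hev : ∀ᶠ n : ℕ in atTop, 1 ≤ n ∧ 64 ≤ m n ∧
      ρ * (m n : ℝ) / 2 ≤ γ n * ((n : ℝ) ^ (3 / 2 - α) / Real.sqrt n) ∧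
      γ n * ((n : ℝ) ^ (3 / 2 - α) / Real.sqrt n) ≤ 3 / 2 * (ρ * (m n : ℝ)) := by
    filter_upwards [hclose, eventually_ge_atTop 1, hm.eventually_ge_atTop 64] with n h1 h2 h3
    have hn0 : (0 : ℝ) < n := by exact_mod_cast h2
    have hg := hγ n h2
    set v := ρ * (n : ℝ) ^ (α - 1) * (m n : ℝ) with hv
    set κ := (n : ℝ) ^ (3 / 2 - α) / Real.sqrt n with hκ
    have hκ0 : 0 < κ := div_pos (Real.rpow_pos_of_pos hn0 _) (Real.sqrt_pos.2 hn0)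
    have hκv : v * κ = ρ * (m n : ℝ) := by
      calc v * κ = ρ * (m n : ℝ) * (κ * (n : ℝ) ^ (α - 1)) := by rw [hv]; ring
        _ = _ := by rw [hpow n h2, mul_one]
    -- Positivity of `γ n` makes its asymptotic equivalent positive, so the case `ρ ≤ 0` cannot
    -- occur.
    have hv0 : 0 < v := by
      by_contra hneg
      push Not at hneg
      rw [abs_of_nonpos hneg] at h1
      linarith [le_abs_self (γ n - v)]
    rw [abs_of_pos hv0, abs_le] at h1
    refine ⟨h2, h3, ?_, ?_⟩ <;> rw [← hκv] <;> nlinarith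
  refine ⟨fun hρ => ?_, fun hρ => ?_⟩
  · refine tendsto_of_tendsto_of_tendsto_of_le_of_le' tendsto_const_nhds (hexp 1 one_pos)
      (Eventually.of_forall fun _ => zero_le) ?_
    filter_upwards [hev] with n ⟨hn, _, hlo, _⟩
    have : NeZero n := ⟨by omega⟩
    have hn0 : (0 : ℝ) < n := by exact_mod_cast hn
    have hr : 0 < (n : ℝ) ^ (3 / 2 - α) * R := mul_pos (Real.rpow_pos_of_pos hn0 _) hR
    set r := (n : ℝ) ^ (3 / 2 - α) * R with hrdef
    refine le_trans (measure_mono fun ω hω => ?_) ((hup n (γ n) (r / 2) (m n) (Ω n) (P n) (X n)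
      (L n) (hγ n hn).le (half_pos hr) (hX n hn) (hL n hn) (hdim n hn) (hind n hn)).trans ?_)
    · exact exists_norm_gt_of_le_circumradius (half_pos hr) (half_lt_self hr) hω
    · apply ENNReal.ofReal_le_ofReal
      have hDm : D ^ m n = Real.exp (m n * Real.log D) := by
        rw [Real.exp_nat_mul, Real.exp_log (by linarith)]
      rw [hDm, mul_assoc, ← Real.exp_add]
      gcongr
      rw [div_lt_iff₀ (by positivity)] at hρ
      have h1 : γ n * (r / 2) / (2 * Real.sqrt n) =
          γ n * ((n : ℝ) ^ (3 / 2 - α) / Real.sqrt n) * (R / 4) := by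
        rw [hrdef]; field_simp; ring
      rw [h1]
      have h2 := mul_le_mul_of_nonneg_left hlo (show 0 ≤ c * (R / 4) by positivity)
      have h3 := mul_le_mul_of_nonneg_left hρ.le (Nat.cast_nonneg (α := ℝ) (m n))
      linarith
  · refine tendsto_of_tendsto_of_tendsto_of_le_of_le' tendsto_const_nhds
      (hexp (c' / 2) (half_pos hc')) (Eventually.of_forall fun _ => zero_le) ?_
    filter_upwards [hev] with n ⟨hn, hm64, _, hhi⟩
    have : NeZero n := ⟨by omega⟩
    have hn0 : (0 : ℝ) < n := by exact_mod_cast hn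
    have hr : 0 < (n : ℝ) ^ (3 / 2 - α) * R := mul_pos (Real.rpow_pos_of_pos hn0 _) hR
    set r := (n : ℝ) ^ (3 / 2 - α) * R with hrdef
    refine (hlow n (γ n) r (m n) (Ω n) (P n) (X n) (L n) (hγ n hn).le hr hm64 (hX n hn)
      (hL n hn) (hdim n hn) (hind n hn)).trans (ENNReal.ofReal_le_ofReal ?_)
    rw [lt_div_iff₀ (by positivity)] at hρ
    have h1 : γ n * r / Real.sqrt n =
        γ n * ((n : ℝ) ^ (3 / 2 - α) / Real.sqrt n) * R := by
      rw [hrdef]; ring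
    have h2 := mul_le_mul_of_nonneg_left hhi (show 0 ≤ C' * R by positivity)
    have h3 := mul_le_mul_of_nonneg_left hρ.le (Nat.cast_nonneg (α := ℝ) (m n))
    refine le_trans (Real.exp_le_exp.2 (?_ : _ ≤ -(c' / 2 * (m n : ℝ)))) ?_
    · rw [h1]; linarith
    · linarith [Real.exp_pos (-(c' / 2 * (m n : ℝ)))]
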